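/- Let $d\ge 2$. A (simple) point process $\mathcal P$ on $\mathbb R^d$ is a random locally finite subset of $\mathbb R^d$, measurable for the $\sigma$-algebra generated by the counts $\mathcal P(B)=\#(\mathcal P\cap B)$ of bounded Borel sets $B$. Its $k$-point correlation function $\rho^{(k)}:(\mathbb R^d)^k\to[0,\infty)$, if it exists, is the Lebesgue density of the factorial moment measure $\alpha^{(k)}(A)=\mathbb E\,\#\{(x_1,\dots,x_k)\in A:\ x_1,\dots,x_k\in\mathcal P \text{ pairwise distinct}\}$. $\mathcal P$ is *admissible* if it is stationary, its intensity $\rho:=\mathbb E\,\mathcal P([-\frac12,\frac12]^d)$ satisfies $0<\rho<\infty$, and $\rho^{(k)}$ exists for every $k\ge 1$. An admissible $\mathcal P$ has *fast decay of correlations* with decay function $\phi$ and decay constants $(C_k)_{k\ge1},(c_k)_{k\ge1}$ if $\phi:[0,\infty)\to[0,1]$ is non-increasing with $\lim_{x\to\infty}x^n\phi(x)=0$ for all $n\ge1$; $C_k\in[1,\infty)$ is non-decreasing in $k$; $c_k\in(0,\infty)$ is non-increasing in $k$; and for all $p,q\ge1$ and Lebesgue-almost all $(x_1,\dots,x_{p+q})\in(\mathbb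 R^d)^{p+q}$, $$\bigl|\rho^{(p+q)}(x_1,\dots,x_{p+q})-\rho^{(p)}(x_1,\dots,x_p)\,\rho^{(q)}(x_{p+1},\dots,x_{p+q})\bigr|\le C_{p+q}\,\phi(c_{p+q}s),\qquad s=\min_{i\le p<j}|x_i-x_j|.$$ $\mathcal P$ is *input of type (A2)* if it has fast decay of correlations for some $\phi$, some $(C_k)$ and $c_k\equiv1$ such that $C_k=O(k^{ak})$ for some $a\in[0,1)$ and $\liminf_{t\to\infty}t^{-b}\log\phi(t)\in(-\infty,0)$ for some $b\in(0,\infty)$. **Proposition.** Let $m\ge1$ and let $\mathcal P_1,\dots,\mathcal P_m$ be i.i.d. copies of an admissible point process $\mathcal P$ on $\mathbb R^d$ having fast decay of correlations with decay function $\phi$ and decay constants $C_k,c_k$. Let $(\kappa_k)_{k\ge0}$ be any non-decreasing sequence of reals with $\kappa_0=\max\{\rho,1\}$ and, for every $k\ge1$, $\rho^{(k)}\le\kappa_k$ Lebesgue-almost everywhere. Then $\mathcal P_0:=\bigcup_{i=1}^m\mathcal P_i$ is an admissible point process having fast decay of correlations with decay function $\phi$ and decay constants $m^k\,m!\,\kappa_k^{m-1}C_k$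 and $c_k$. Further, if $\mathcal P$ is input of type (A2) and there is $\lambda\in(0,\infty)$ with $\kappa_k\le\lambda^k$ for all $k\ge1$, then $\mathcal P_0$ is also input of type (A2). -/

import Mathlib

open MeasureTheory ProbabilityTheory Filter Topology Asymptotics
open scoped ENNReal

/-- A locally finite set of points of `ℝ^d` (equivalently, a simple Radon counting measure). -/
@[ext]
structure Configuration (d : ℕ) where
  points : Set (EuclideanSpace ℝ (Fin d))
  locallyFinite : ∀ B : Set (EuclideanSpace ℝ (Fin d)),
    Bornology.IsBounded B → (points ∩ B).Finite

namespace Configuration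

/-- The number of points in `B`; it is only used for bounded `B`, where the count is finite. -/
noncomputable def count {d : ℕ} (B : Set (EuclideanSpace ℝ (Fin d)))
    (S : Configuration d) : ℕ :=
  (S.points ∩ B).ncard

/-- The canonical σ-algebra: the smallest one that makes the number of points in every bounded
Borel set measurable. -/
noncomputable instance (d : ℕ) : MeasurableSpace (Configuration d) :=
  ⨆ B : {B : Set (EuclideanSpace ℝ (Fin d)) // MeasurableSet B ∧ Bornology.IsBounded B},
    MeasurableSpace.comap (count B.1) ⊤

/-- The translate `S + v`. -/
def translate {d : ℕ} (v : EuclideanSpace ℝ (Fin d)) (S : Configuration d) :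
    Configuration d where
  points := (fun x => x + v) '' S.points
  locallyFinite := by
    intro B hB
    have h1 : Bornology.IsBounded ((fun x => x + -v) '' B) :=
      ((LipschitzWith.id.add (LipschitzWith.const (-v))).isBounded_image hB)
    refine ((S.locallyFinite _ h1).image (fun x => x + v)).subset ?_
    rintro _ ⟨⟨x, hx, rfl⟩, hxB⟩
    exact ⟨x, ⟨hx, x + v, hxB, by simp⟩, rfl⟩

/-- The union of finitely many configurations. -/
def iUnion {d m : ℕ} (S : Fin m → Configuration d) : Configuration d where
  points := ⋃ i, (S i).points
  locallyFinite := by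
    intro B hB
    rw [Set.iUnion_inter]
    exact Set.finite_iUnion fun i => (S i).locallyFinite B hB

/-- The support of the `k`-th factorial power: the `k`-tuples of pairwise distinct points. -/
def factorialPower {d : ℕ} (S : Configuration d) (k : ℕ) :
    Set (Fin k → EuclideanSpace ℝ (Fin d)) :=
  {x | Function.Injective x ∧ ∀ i, x i ∈ S.points}

end Configuration

section PointProcess

/-- The superposition `P₁ ∪ ⋯ ∪ P_m` of point processes on a common probability space. -/
def superposition {Ω : Type*} {d m : ℕ} (P : Fin m → Ω → Configuration d) :
    Ω → Configuration d :=
  fun ω => Configuration.iUnion fun i => P i ω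

/-- The `k`-th factorial moment measure `α^{(k)}(A)`: the expected number of `k`-tuples of
pairwise distinct points of `P` that lie in `A`. -/
noncomputable def factorialMoment {Ω : Type*} [MeasurableSpace Ω] {d : ℕ}
    (P : Ω → Configuration d) (μ : Measure Ω) (k : ℕ)
    (A : Set (Fin k → EuclideanSpace ℝ (Fin d))) : ℝ≥0∞ :=
  ∫⁻ ω, (((P ω).factorialPower k ∩ A).encard : ℝ≥0∞) ∂μ

/-- `ρ` is a version of the `k`-point correlation function of `P`, that is, a density of the
`k`-th factorial moment measure with respect to Lebesgue measure on `(ℝ^d)^k`. -/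
structure IsCorrelationFunction {Ω : Type*} [MeasurableSpace Ω] {d : ℕ}
    (P : Ω → Configuration d) (μ : Measure Ω) (k : ℕ)
    (ρ : (Fin k → EuclideanSpace ℝ (Fin d)) → ℝ) : Prop where
  measurable : Measurable ρ
  nonneg : ∀ x, 0 ≤ ρ x
  density : ∀ A : Set (Fin k → EuclideanSpace ℝ (Fin d)), MeasurableSet A →
    factorialMoment P μ k A = ∫⁻ x in A, ENNReal.ofReal (ρ x)

/-- The intensity: the expected number of points in the unit cube `[-1/2, 1/2]^d`. -/
noncomputable def intensity {Ω : Type*} [MeasurableSpace Ω] {d : ℕ}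
    (P : Ω → Configuration d) (μ : Measure Ω) : ℝ≥0∞ :=
  ∫⁻ ω, (((P ω).points ∩ {x | ∀ i, |x i| ≤ 1 / 2}).encard : ℝ≥0∞) ∂μ

/-- Admissible point processes. Simplicity is built into `Configuration`. -/
structure IsAdmissible {Ω : Type*} [MeasurableSpace Ω] {d : ℕ}
    (P : Ω → Configuration d) (μ : Measure Ω) : Prop where
  measurable : Measurable P
  stationary : ∀ v : EuclideanSpace ℝ (Fin d),
    IdentDistrib (fun ω => (P ω).translate v) P μ μ
  intensity_pos : 0 < intensity P μ
  intensity_lt_top : intensity P μ < ∞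
  exists_correlation : ∀ k : ℕ, ∃ ρ, IsCorrelationFunction P μ k ρ

/-- The distance `s` between the first `p` and the last `q` points of a `(p+q)`-tuple. -/
noncomputable def blockDist {d : ℕ} (p q : ℕ)
    (x : Fin (p + q) → EuclideanSpace ℝ (Fin d)) : ℝ :=
  ⨅ ij : Fin p × Fin q, dist (x (Fin.castAdd q ij.1)) (x (Fin.natAdd p ij.2))

/-- A non-increasing, fast decreasing function `φ : [0,∞) → [0,1]`; values at negative
arguments play no role. -/
structure IsFastDecreasing (φ : ℝ → ℝ) : Prop where
  mem_Icc : ∀ x, 0 ≤ x → φ x ∈ Set.Icc (0 : ℝ) 1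
  antitone : AntitoneOn φ (Set.Ici 0)
  decay : ∀ n : ℕ, 1 ≤ n → Tendsto (fun x : ℝ => x ^ n * φ x) atTop (𝓝 0)

/-- `P` is an admissible point process having fast decay of correlations with decay function `φ`
and decay constants `C k`, `c k` (`k ≥ 1`). Correlation functions are densities, hence determined
up to null sets, and so the estimate is required for almost every tuple. -/
structure HasFastDecay {Ω : Type*} [MeasurableSpace Ω] {d : ℕ}
    (P : Ω → Configuration d) (μ : Measure Ω) (φ : ℝ → ℝ) (C c : ℕ → ℝ) : Prop where
  admissible : IsAdmissible P μ
  fastDecreasing : IsFastDecreasing φ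
  one_le_C : ∀ k, 1 ≤ k → 1 ≤ C k
  monotone_C : MonotoneOn C (Set.Ici 1)
  c_pos : ∀ k, 1 ≤ k → 0 < c k
  antitone_c : AntitoneOn c (Set.Ici 1)
  mixing : ∀ ρ : (k : ℕ) → (Fin k → EuclideanSpace ℝ (Fin d)) → ℝ,
    (∀ k, IsCorrelationFunction P μ k (ρ k)) →
    ∀ p q : ℕ, 1 ≤ p → 1 ≤ q →
      ∀ᵐ x : Fin (p + q) → EuclideanSpace ℝ (Fin d),
        |ρ (p + q) x - ρ p (fun i => x (Fin.castAdd q i)) * ρ q (fun j => x (Fin.natAdd p j))|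
          ≤ C (p + q) * φ (c (p + q) * blockDist p q x)

/-- The constants `κ k` bound the correlation functions of `P`, with the usual normalization:
non-decreasing in `k`, with `κ 0` the maximum of the intensity and `1`. -/
structure IsCorrelationBound {Ω : Type*} [MeasurableSpace Ω] {d : ℕ}
    (P : Ω → Configuration d) (μ : Measure Ω) (κ : ℕ → ℝ) : Prop where
  zero : κ 0 = max (intensity P μ).toReal 1
  monotone : Monotone κ
  bound : ∀ k : ℕ, 1 ≤ k → ∀ ρ : (Fin k → EuclideanSpace ℝ (Fin d)) → ℝ,
    IsCorrelationFunction P μ k ρ → ∀ᵐ x, ρ x ≤ κ k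

/-- Admissible input of type (A2): fast decay of correlations with `c k = 1`,
`C k = O(k ^ (a k))` for some `a ∈ [0,1)`, and
`liminf_{t → ∞} log (φ t) / t ^ b ∈ (-∞, 0)` for some `b > 0` (with `log 0 = -∞`). -/
def IsA2Input {Ω : Type*} [MeasurableSpace Ω] {d : ℕ}
    (P : Ω → Configuration d) (μ : Measure Ω) : Prop :=
  ∃ (φ : ℝ → ℝ) (C : ℕ → ℝ),
    HasFastDecay P μ φ C (fun _ => 1) ∧
    (∃ a : ℝ, 0 ≤ a ∧ a < 1 ∧ C =O[atTop] fun k : ℕ => (k : ℝ) ^ (a * (k : ℝ))) ∧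
    ∃ b : ℝ, 0 < b ∧
      ⊥ < liminf (fun t : ℝ => ENNReal.log (ENNReal.ofReal (φ t)) / ((t ^ b : ℝ) : EReal)) atTop ∧
      liminf (fun t : ℝ => ENNReal.log (ENNReal.ofReal (φ t)) / ((t ^ b : ℝ) : EReal)) atTop < 0

end PointProcess

/-! Colour each point of the union by the copy it comes from. Two distinct copies almost surely
share no point: a pair drawn from two independent copies has a density, so it does not charge the
diagonal (`ae_disjoint_points`). Hence a tuple of distinct points of the union has exactly one
colouring, and by independence the correlation function of the union is the sum, over all colourings
`f`, of the product over colours `i` of the correlation function of `P` at the points coloured `i`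
(`isTupleDensity_superposition`). Since the factors live on the fibres of `f`, densities are
considered on arbitrary finite index types.

For two blocks with `k` points in all, the product of the two block densities is again a sum over
colourings of all `k` points. For a fixed colouring, the joint term and the split term are products
of `m` factors in `[0, κ k]`, and corresponding factors differ by at most `C k * φ (c k * t)`.
Telescoping costs `m * κ k ^ (m - 1)`, there are `m ^ k` colourings, and `m ≤ m!`. That a split
factor is at most `κ k`, and not merely `κ k ^ 2`, follows by moving one block to infinity
(`HasFastDecay.ae_mul_le`).

For (A2), `φ` and `c` do not change, and the new prefactor of `C k` grows at most geometrically, so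
raising the exponent `a` to `(a + 1) / 2 < 1` absorbs it. -/

theorem Set.encard_univ_pi {ι : Type*} [Fintype ι] {α : ι → Type*} (s : ∀ i, Set (α i)) :
    (Set.univ.pi s).encard = ∏ i, (s i).encard := by
  simp only [Set.encard, ENat.card]
  rw [Cardinal.toENat_congr (Equiv.Set.univPi s), Cardinal.mk_pi, Cardinal.prod_eq_of_fintype,
    Cardinal.toENat_lift, map_prod]

theorem ENat.toENNReal_prod {ι : Type*} (s : Finset ι) (f : ι → ℕ∞) :
    ((∏ i ∈ s, f i : ℕ∞) : ℝ≥0∞) = ∏ i ∈ s, (f i : ℝ≥0∞) :=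
  map_prod ENat.toENNRealRingHom f s

namespace Configuration

variable {d : ℕ}

theorem countable_points (S : Configuration d) : S.points.Countable := by
  have h : S.points = ⋃ n : ℕ, S.points ∩ Metric.ball 0 (n : ℝ) := by
    rw [← Set.inter_iUnion, Metric.iUnion_ball_nat, Set.inter_univ]
  rw [h]
  exact Set.countable_iUnion fun n => (S.locallyFinite _ Metric.isBounded_ball).countable

theorem measurable_count {B : Set (EuclideanSpace ℝ (Fin d))} (hB : MeasurableSet B)
    (hB' : Bornology.IsBounded B) : Measurable (count B) := by
  rw [measurable_iff_comap_le]
  exact le_iSup (fun B : {B : Set (EuclideanSpace ℝ (Fin d)) //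
    MeasurableSet B ∧ Bornology.IsBounded B} => MeasurableSpace.comap (count B.1) ⊤) ⟨B, hB, hB'⟩

theorem measurable_of_count {α : Type*} [MeasurableSpace α] {f : α → Configuration d}
    (h : ∀ B : Set (EuclideanSpace ℝ (Fin d)), MeasurableSet B → Bornology.IsBounded B →
      Measurable fun a => count B (f a)) : Measurable f := by
  rw [measurable_iff_comap_le]
  change MeasurableSpace.comap f (⨆ B : _, _) ≤ _
  rw [MeasurableSpace.comap_iSup]
  refine iSup_le fun B => ?_
  rw [MeasurableSpace.comap_comp]
  exact measurable_iff_comap_le.1 (h B.1 B.2.1 B.2.2)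

theorem encard_points_inter (S : Configuration d) {B : Set (EuclideanSpace ℝ (Fin d))}
    (hB : Bornology.IsBounded B) : (S.points ∩ B).encard = (count B S : ℕ∞) :=
  ((S.locallyFinite B hB).cast_ncard_eq).symm

/-! ### Counting measures on tuples of points, and their measurability -/

section Tuples

variable {ι : Type*} [Fintype ι]

/-- The tuples whose `j`-th entry is a point of `S j`. -/
def tuples (S : ι → Configuration d) : Set (ι → EuclideanSpace ℝ (Fin d)) :=
  Set.univ.pi fun j => (S j).points

theorem countable_tuples (S : ι → Configuration d) : (tuples S).Countable :=
  Set.countable_univ_pi fun j => (S j).countable_points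

/-- The counting measure on the tuples whose `j`-th entry is a point of `S j`. -/
noncomputable def tupleMeasure (S : ι → Configuration d) :
    Measure (ι → EuclideanSpace ℝ (Fin d)) :=
  Measure.count.restrict (tuples S)

theorem tupleMeasure_apply (S : ι → Configuration d)
    {A : Set (ι → EuclideanSpace ℝ (Fin d))} (hA : MeasurableSet A) :
    tupleMeasure S A = ((tuples S ∩ A).encard : ℝ≥0∞) := by
  rw [tupleMeasure, Measure.restrict_apply hA,
    Measure.count_apply (hA.inter (countable_tuples S).measurableSet), Set.inter_comm]

/-- The cube of all tuples with entries in the ball of radius `n` around the origin. -/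
def tupleBall (ι : Type*) (d n : ℕ) : Set (ι → EuclideanSpace ℝ (Fin d)) :=
  Set.univ.pi fun _ => Metric.ball 0 (n : ℝ)

theorem measurableSet_tupleBall (n : ℕ) : MeasurableSet (tupleBall ι d n) :=
  MeasurableSet.univ_pi fun _ => measurableSet_ball

theorem monotone_tupleBall (κ : Type*) : Monotone (tupleBall κ d) := fun _ _ h =>
  Set.pi_mono fun _ _ => Metric.ball_subset_ball (by exact_mod_cast h)

theorem iUnion_tupleBall : ⋃ n, tupleBall ι d n = Set.univ := by
  refine Set.eq_univ_of_forall fun x => ?_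
  obtain ⟨n, hn⟩ := exists_nat_gt (∑ i, ‖x i‖)
  refine Set.mem_iUnion.2 ⟨n, fun i _ => ?_⟩
  rw [mem_ball_zero_iff]
  exact (Finset.single_le_sum (f := fun i => ‖x i‖) (fun i _ => norm_nonneg _)
    (Finset.mem_univ i)).trans_lt hn

theorem encard_tuples_inter_pi_ball (S : ι → Configuration d)
    (B : ι → Set (EuclideanSpace ℝ (Fin d))) (n : ℕ) :
    (tuples S ∩ (Set.univ.pi B ∩ tupleBall ι d n)).encard =
      ∏ j, (count (B j ∩ Metric.ball 0 (n : ℝ)) (S j) : ℕ∞) := by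
  rw [tupleBall, tuples, ← Set.pi_inter_distrib, ← Set.pi_inter_distrib, Set.encard_univ_pi]
  exact Finset.prod_congr rfl fun j _ =>
    (S j).encard_points_inter (Metric.isBounded_ball.subset Set.inter_subset_right)

/-- On a box the count factorizes into counts of the single configurations, which are measurable by
definition. Boxes form a π-system, but the argument needs finite measures; hence the restriction to
balls, followed by a monotone limit. -/
theorem measurable_tupleMeasure : Measurable (tupleMeasure (d := d) (ι := ι)) := by
  have key : ∀ n, Measurable fun S : ι → Configuration d =>
      (tupleMeasure S).restrict (tupleBall ι d n) := by
    intro n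
    have hrect : ∀ B : ι → Set (EuclideanSpace ℝ (Fin d)), (∀ j, MeasurableSet (B j)) →
        ∀ S : ι → Configuration d, (tupleMeasure S).restrict (tupleBall ι d n) (Set.univ.pi B) =
          ∏ j, (count (B j ∩ Metric.ball 0 (n : ℝ)) (S j) : ℝ≥0∞) := by
      intro B hB S
      have hB' : MeasurableSet (Set.univ.pi B) := MeasurableSet.univ_pi hB
      rw [Measure.restrict_apply hB', tupleMeasure_apply S (hB'.inter (measurableSet_tupleBall n)),
        encard_tuples_inter_pi_ball, ENat.toENNReal_prod]
      rfl
    have hmeas : ∀ B : ι → Set (EuclideanSpace ℝ (Fin d)), (∀ j, MeasurableSet (B j)) →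
        Measurable fun S : ι → Configuration d =>
          (tupleMeasure S).restrict (tupleBall ι d n) (Set.univ.pi B) := by
      intro B hB
      simp_rw [hrect B hB]
      refine Finset.measurable_prod _ fun j _ => ?_
      exact (measurable_from_top (f := fun k : ℕ => (k : ℝ≥0∞))).comp
        ((measurable_count ((hB j).inter measurableSet_ball)
        (Metric.isBounded_ball.subset Set.inter_subset_right)).comp (measurable_pi_apply j))
    have hfin : ∀ S : ι → Configuration d,
        IsFiniteMeasure ((tupleMeasure S).restrict (tupleBall ι d n)) := by
      intro S
      constructor
      rw [← Set.pi_univ Set.univ, hrect _ fun _ => MeasurableSet.univ]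
      exact ENNReal.prod_lt_top fun j _ => ENNReal.natCast_lt_top _
    refine Measurable.measure_of_isPiSystem generateFrom_pi.symm isPiSystem_pi ?_ ?_
    · rintro _ ⟨B, hB, rfl⟩
      exact hmeas B fun j => hB j (Set.mem_univ j)
    · rw [← Set.pi_univ Set.univ]
      exact hmeas _ fun _ => MeasurableSet.univ
  refine Measure.measurable_of_measurable_coe _ fun A hA => ?_
  have h : ∀ S : ι → Configuration d,
      tupleMeasure S A = ⨆ n, (tupleMeasure S).restrict (tupleBall ι d n) A := by
    intro S
    have hmono : Monotone fun n => A ∩ tupleBall ι d n := fun a b h =>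
      Set.inter_subset_inter_right _ (monotone_tupleBall ι h)
    simp_rw [Measure.restrict_apply hA]
    rw [← hmono.measure_iUnion, ← Set.inter_iUnion, iUnion_tupleBall, Set.inter_univ]
  simp_rw [h]
  exact Measurable.iSup fun n => (Measure.measurable_coe hA).comp (key n)

theorem measurable_encard_tuples {A : Set (ι → EuclideanSpace ℝ (Fin d))}
    (hA : MeasurableSet A) :
    Measurable fun S : ι → Configuration d => ((tuples S ∩ A).encard : ℝ≥0∞) := by
  simp_rw [← tupleMeasure_apply _ hA]
  exact (Measure.measurable_coe hA).comp measurable_tupleMeasure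

theorem measurable_of_natCast_ennreal {α : Type*} [MeasurableSpace α] {f : α → ℕ}
    (h : Measurable fun a => (f a : ℝ≥0∞)) : Measurable f := by
  refine measurable_to_countable' fun n => ?_
  have : f ⁻¹' {n} = (fun a => (f a : ℝ≥0∞)) ⁻¹' {(n : ℝ≥0∞)} := by
    ext a; simp
  rw [this]
  exact h (measurableSet_singleton _)

end Tuples

/-- The set of pairwise distinct tuples of points of `S`, with an arbitrary index type. -/
def distinctTuples (ι : Type*) (S : Configuration d) : Set (ι → EuclideanSpace ℝ (Fin d)) :=
  {x | Function.Injective x ∧ ∀ i, x i ∈ S.points}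

theorem measurableSet_eq_coord {ι : Type*} (i j : ι) :
    MeasurableSet {x : ι → EuclideanSpace ℝ (Fin d) | x i = x j} :=
  measurableSet_eq_fun (measurable_pi_apply i) (measurable_pi_apply j)

theorem measurableSet_injective {ι : Type*} [Countable ι] :
    MeasurableSet {x : ι → EuclideanSpace ℝ (Fin d) | Function.Injective x} := by
  have : {x : ι → EuclideanSpace ℝ (Fin d) | Function.Injective x} =
      ⋂ (i : ι) (j : ι) (_ : i ≠ j), {x | x i = x j}ᶜ := by
    ext x
    simp only [Function.Injective, Set.mem_ofPred_eq, Set.mem_iInter, Set.mem_compl_iff]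
    exact ⟨fun h i j hij he => hij (h he), fun h i j he => by_contra fun hij => h i j hij he⟩
  rw [this]
  exact .iInter fun i => .iInter fun j => .iInter fun _ => (measurableSet_eq_coord i j).compl

theorem distinctTuples_inter {ι : Type*} (S : Configuration d)
    (A : Set (ι → EuclideanSpace ℝ (Fin d))) :
    distinctTuples ι S ∩ A = tuples (fun _ => S) ∩ ({x | Function.Injective x} ∩ A) := by
  ext x
  simp only [distinctTuples, tuples, Set.mem_inter_iff, Set.mem_ofPred_eq, Set.mem_univ_pi]
  tauto

theorem measurable_encard_distinctTuples {ι : Type*} [Fintype ι]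
    {A : Set (ι → EuclideanSpace ℝ (Fin d))} (hA : MeasurableSet A) :
    Measurable fun S : Configuration d => ((distinctTuples ι S ∩ A).encard : ℝ≥0∞) := by
  simp_rw [distinctTuples_inter]
  exact (measurable_encard_tuples (measurableSet_injective.inter hA)).comp
    (measurable_pi_lambda _ fun _ => measurable_id)

/-! ### Measurability of translations and unions -/

theorem measurable_translate (v : EuclideanSpace ℝ (Fin d)) : Measurable (translate v) := by
  refine measurable_of_count fun B hB hB' => ?_
  have h : ∀ S : Configuration d, count B (translate v S) = count ((fun x => x + v) ⁻¹' B) S := by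
    intro S
    have : (translate v S).points ∩ B = (fun x => x + v) '' (S.points ∩ (fun x => x + v) ⁻¹' B) :=
      (Set.image_inter_preimage _ _ _).symm
    rw [count, this, Set.ncard_image_of_injective _ (add_left_injective v), count]
  simp_rw [h]
  refine measurable_count (hB.preimage (measurable_add_const v)) ?_
  have := (LipschitzWith.id.add (LipschitzWith.const (-v))).isBounded_image hB'
  refine this.subset fun x hx => ⟨x + v, hx, by simp⟩

/-- The union of two configurations. -/
def union (S T : Configuration d) : Configuration d where
  points := S.points ∪ T.points
  locallyFinite B hB := by
    rw [Set.union_inter_distrib_right]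
    exact (S.locallyFinite B hB).union (T.locallyFinite B hB)

/-- Inclusion–exclusion reduces the claim to the number of common points, which is the number of
pairs, one entry from each configuration, lying on the diagonal. -/
theorem measurable_union :
    Measurable fun p : Configuration d × Configuration d => union p.1 p.2 := by
  refine measurable_of_count fun B hB hB' => ?_
  have h : ∀ p : Configuration d × Configuration d, count B (union p.1 p.2) =
      count B p.1 + count B p.2 - (p.1.points ∩ p.2.points ∩ B).ncard := by
    intro p
    rw [count, count, count, ← Set.ncard_union_add_ncard_inter _ _ (p.1.locallyFinite B hB')
      (p.2.locallyFinite B hB'), ← Set.union_inter_distrib_right, ← Set.inter_inter_distrib_right,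
      Nat.add_sub_cancel]
    rfl
  simp_rw [h]
  have hc := measurable_count hB hB'
  have hi : Measurable fun p : Configuration d × Configuration d =>
      (p.1.points ∩ p.2.points ∩ B).ncard := by
    refine measurable_of_natCast_ennreal ?_
    let A : Set (Fin 2 → EuclideanSpace ℝ (Fin d)) := {x | x 0 = x 1} ∩ (fun x => x 0) ⁻¹' B
    have hA : MeasurableSet A := (measurableSet_eq_coord 0 1).inter (measurable_pi_apply 0 hB)
    have e : ∀ p : Configuration d × Configuration d,
        ((p.1.points ∩ p.2.points ∩ B).ncard : ℝ≥0∞) =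
          ((tuples ![p.1, p.2] ∩ A).encard : ℝ≥0∞) := by
      intro p
      have himg : tuples ![p.1, p.2] ∩ A = (fun x => ![x, x]) '' (p.1.points ∩ p.2.points ∩ B) := by
        ext x
        simp only [tuples, A, Set.mem_inter_iff, Set.mem_univ_pi, Fin.forall_fin_two,
          Set.mem_ofPred_eq, Set.mem_preimage, Set.mem_image, Matrix.cons_val_zero,
          Matrix.cons_val_one]
        constructor
        · rintro ⟨⟨h0, h1⟩, h01, hb⟩
          refine ⟨x 0, ⟨⟨h0, h01 ▸ h1⟩, hb⟩, ?_⟩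
          ext i : 1
          fin_cases i
          · rfl
          · exact h01
        · rintro ⟨y, ⟨⟨h0, h1⟩, hb⟩, rfl⟩
          exact ⟨⟨h0, h1⟩, rfl, hb⟩
      have hinj : Function.Injective fun x : EuclideanSpace ℝ (Fin d) => ![x, x] :=
        fun x y hxy => congrFun hxy 0
      have hfin : (p.1.points ∩ p.2.points ∩ B).Finite :=
        (p.1.locallyFinite B hB').subset fun x hx => ⟨hx.1.1, hx.2⟩
      rw [himg, hinj.encard_image, ← hfin.cast_ncard_eq]
      rfl
    simp_rw [e]
    refine (measurable_encard_tuples hA).comp (measurable_pi_lambda _ fun i => ?_)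
    fin_cases i
    · exact measurable_fst
    · exact measurable_snd
  exact ((hc.comp measurable_fst).add (hc.comp measurable_snd)).sub hi

theorem measurable_iUnion {m : ℕ} : Measurable (iUnion (d := d) (m := m)) := by
  induction m with
  | zero =>
    exact measurable_const' fun S T => congrArg _ (Subsingleton.elim S T)
  | succ m ih =>
    have : (iUnion (d := d) (m := m + 1)) =
        fun S => union (S 0) (iUnion fun i : Fin m => S i.succ) := by
      ext S x
      simp [iUnion, union, Fin.exists_fin_succ]
    rw [this]
    have hs : Measurable fun S : Fin (m + 1) → Configuration d => fun i : Fin m => S i.succ :=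
      measurable_pi_lambda _ fun i => measurable_pi_apply i.succ
    have h0 : Measurable fun S : Fin (m + 1) → Configuration d => S 0 := measurable_pi_apply 0
    exact measurable_union.comp (h0.prodMk (ih.comp hs))

end Configuration

/-! ### Change of the index set of a tuple -/

section Reindexing

variable {ι κ : Type*} [Fintype ι] [Fintype κ] {d : ℕ}

theorem measurePreserving_comp_equiv (e : ι ≃ κ) :
    MeasurePreserving (fun x : κ → EuclideanSpace ℝ (Fin d) => x ∘ e) :=
  (volume_measurePreserving_piCongrLeft (fun _ : κ => EuclideanSpace ℝ (Fin d)) e).symm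

/-- Up to relabelling, this is a coordinate projection. It carries almost-everywhere statements
about part of a tuple to the whole tuple. -/
theorem quasiMeasurePreserving_comp_injective {e : ι → κ} (he : Function.Injective e) :
    Measure.QuasiMeasurePreserving (fun x : κ → EuclideanSpace ℝ (Fin d) => x ∘ e) := by
  classical
  have h1 := (volume_preserving_piEquivPiSubtypeProd
    (fun _ : κ => EuclideanSpace ℝ (Fin d)) (· ∈ Set.range e)).quasiMeasurePreserving
  have h2 := Measure.quasiMeasurePreserving_fst.comp h1
  have h3 := (measurePreserving_comp_equiv (d := d) (Equiv.ofInjective e he)).quasiMeasurePreserving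
  refine h3.comp (f := fun x : κ → EuclideanSpace ℝ (Fin d) => fun i : Set.range e => x i) ?_
  convert! h2

end Reindexing

/-! ### Correlation functions on arbitrary finite index types -/

section TupleDensity

open Configuration

variable {Ω Ω' : Type*} [MeasurableSpace Ω] [MeasurableSpace Ω'] {d : ℕ}
  {ι κ : Type*} [Fintype ι] [Fintype κ]

/-- `r` is a density of the factorial moment measure of `P` on tuples indexed by `ι`. -/
structure IsTupleDensity (P : Ω → Configuration d) (μ : Measure Ω) (ι : Type*) [Fintype ι]
    (r : (ι → EuclideanSpace ℝ (Fin d)) → ℝ) : Prop where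
  measurable : Measurable r
  nonneg : ∀ x, 0 ≤ r x
  density : ∀ A : Set (ι → EuclideanSpace ℝ (Fin d)), MeasurableSet A →
    ∫⁻ ω, ((distinctTuples ι (P ω) ∩ A).encard : ℝ≥0∞) ∂μ = ∫⁻ x in A, ENNReal.ofReal (r x)

variable {P : Ω → Configuration d} {μ : Measure Ω} {r r' : (ι → EuclideanSpace ℝ (Fin d)) → ℝ}

theorem isCorrelationFunction_iff_isTupleDensity {k : ℕ}
    {ρ : (Fin k → EuclideanSpace ℝ (Fin d)) → ℝ} :
    IsCorrelationFunction P μ k ρ ↔ IsTupleDensity P μ (Fin k) ρ :=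
  ⟨fun h => ⟨h.1, h.2, h.3⟩, fun h => ⟨h.1, h.2, h.3⟩⟩

namespace IsTupleDensity

theorem ae_eq (h : IsTupleDensity P μ ι r) (h' : IsTupleDensity P μ ι r') : r =ᵐ[volume] r' := by
  have := ae_eq_of_forall_setLIntegral_eq_of_sigmaFinite (μ := volume)
    h.measurable.ennreal_ofReal h'.measurable.ennreal_ofReal fun A hA _ => by
      rw [← h.density A hA, ← h'.density A hA]
  filter_upwards [this] with x hx
  exact (ENNReal.ofReal_eq_ofReal_iff (h.nonneg x) (h'.nonneg x)).1 hx

theorem reindex (h : IsTupleDensity P μ ι r) (e : ι ≃ κ) :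
    IsTupleDensity P μ κ fun x => r (x ∘ e) where
  measurable := h.measurable.comp (measurePreserving_comp_equiv e).measurable
  nonneg x := h.nonneg _
  density A hA := by
    have hmp := measurePreserving_comp_equiv (d := d) e
    have hms := measurePreserving_comp_equiv (d := d) e.symm
    let A' : Set (ι → EuclideanSpace ℝ (Fin d)) := (fun x => x ∘ e.symm) ⁻¹' A
    have hA' : MeasurableSet A' := hms.measurable hA
    have hAA : A = (fun x => x ∘ e) ⁻¹' A' := by
      ext x
      simp [A', Function.comp_assoc]
    have hinj : Function.Injective fun x : ι → EuclideanSpace ℝ (Fin d) => x ∘ e.symm :=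
      e.symm.surjective.injective_comp_right
    have himg : ∀ S : Configuration d,
        distinctTuples κ S ∩ A = (fun x => x ∘ e.symm) '' (distinctTuples ι S ∩ A') := by
      intro S
      ext x
      constructor
      · rintro ⟨⟨h1, h2⟩, h3⟩
        refine ⟨x ∘ e, ⟨⟨h1.comp e.injective, fun i => h2 _⟩, ?_⟩, ?_⟩
        · simpa [A', Function.comp_assoc] using h3
        · simp [Function.comp_assoc]
      · rintro ⟨y, ⟨⟨h1, h2⟩, h3⟩, rfl⟩
        exact ⟨⟨h1.comp e.symm.injective, fun i => h2 _⟩, h3⟩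
    simp_rw [himg, hinj.encard_image]
    rw [h.density A' hA', hAA]
    exact (hmp.setLIntegral_comp_preimage hA' h.measurable.ennreal_ofReal).symm

theorem of_identDistrib {μ' : Measure Ω'} {Q : Ω' → Configuration d} (h : IsTupleDensity P μ ι r)
    (hQ : IdentDistrib Q P μ' μ) : IsTupleDensity Q μ' ι r where
  measurable := h.measurable
  nonneg := h.nonneg
  density A hA := by
    rw [← h.density A hA]
    exact (hQ.comp (measurable_encard_distinctTuples hA)).lintegral_eq

/-- Stationarity: the shifted function is another version of the same density. This is what lets one
block be moved to infinity later. -/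
theorem comp_add (h : IsTupleDensity P μ ι r)
    (v : EuclideanSpace ℝ (Fin d)) (hst : IdentDistrib (fun ω => (P ω).translate v) P μ μ) :
    IsTupleDensity P μ ι fun x => r (x + fun _ => v) where
  measurable := h.measurable.comp (measurable_add_const _)
  nonneg x := h.nonneg _
  density A hA := by
    let w : ι → EuclideanSpace ℝ (Fin d) := fun _ => v
    let A' : Set (ι → EuclideanSpace ℝ (Fin d)) := (fun x => x - w) ⁻¹' A
    have hA' : MeasurableSet A' := measurable_sub_const w hA
    have hAA : A = (fun x => x + w) ⁻¹' A' := by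
      ext x
      simp [A']
    have himg : ∀ S : Configuration d,
        distinctTuples ι (S.translate v) ∩ A' = (fun x => x + w) '' (distinctTuples ι S ∩ A) := by
      intro S
      ext x
      constructor
      · rintro ⟨⟨h1, h2⟩, h3⟩
        refine ⟨x - w, ⟨⟨fun i j hij => h1 (sub_left_injective hij), fun i => ?_⟩, h3⟩, by simp⟩
        obtain ⟨y, hy, hyx⟩ := h2 i
        have : (x - w) i = y := sub_eq_of_eq_add hyx.symm
        rwa [this]
      · rintro ⟨y, ⟨⟨h1, h2⟩, h3⟩, rfl⟩
        refine ⟨⟨fun i j hij => h1 (add_left_injective v hij), fun i => ⟨y i, h2 i, rfl⟩⟩, ?_⟩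
        simpa [A'] using h3
    have h1 : ∫⁻ ω, ((distinctTuples ι ((P ω).translate v) ∩ A').encard : ℝ≥0∞) ∂μ =
        ∫⁻ ω, ((distinctTuples ι (P ω) ∩ A').encard : ℝ≥0∞) ∂μ :=
      (hst.comp (measurable_encard_distinctTuples hA')).lintegral_eq
    simp_rw [himg, (add_left_injective w).encard_image] at h1
    rw [h1, h.density A' hA', hAA]
    exact ((measurePreserving_add_right volume w).setLIntegral_comp_preimage hA'
      h.measurable.ennreal_ofReal).symm

/-- There is exactly one empty tuple, and the total mass is 1. Colours that are not used therefore
contribute the factor 1. -/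
theorem ae_eq_one [IsProbabilityMeasure μ] [IsEmpty ι] (h : IsTupleDensity P μ ι r) :
    ∀ᵐ x, r x = 1 := by
  refine h.ae_eq (r' := fun _ => 1) ⟨measurable_const, fun _ => zero_le_one, fun A hA => ?_⟩
  have hA' : ∀ S : Configuration d, distinctTuples ι S ∩ A = A := fun S =>
    Set.inter_eq_right.2 fun x _ => ⟨fun i => isEmptyElim i, fun i => isEmptyElim i⟩
  simp only [hA', lintegral_const, measure_univ, mul_one, ENNReal.ofReal_one,
    MeasurableSet.univ, Measure.restrict_apply, Set.univ_inter, one_mul]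
  rcases Set.eq_empty_or_nonempty A with rfl | hne
  · simp
  · have : A = Set.univ := Subsingleton.eq_univ_of_nonempty hne
    subst this
    rw [← Set.pi_univ Set.univ, volume_pi_pi, Set.encard_univ_pi]
    simp

end IsTupleDensity

theorem IsAdmissible.exists_isTupleDensity (h : IsAdmissible P μ) (ι : Type*) [Fintype ι] :
    ∃ r, IsTupleDensity P μ ι r := by
  obtain ⟨ρ, hρ⟩ := h.exists_correlation (Fintype.card ι)
  exact ⟨_, (isCorrelationFunction_iff_isTupleDensity.1 hρ).reindex (Fintype.equivFin ι).symm⟩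

theorem IsCorrelationBound.one_le {κ : ℕ → ℝ} (h : IsCorrelationBound P μ κ) (k : ℕ) :
    1 ≤ κ k :=
  (le_max_right _ _).trans (h.zero.symm.le.trans (h.monotone k.zero_le))

theorem IsTupleDensity.ae_le [IsProbabilityMeasure μ] {κ : ℕ → ℝ}
    (h : IsTupleDensity P μ ι r) (hκ : IsCorrelationBound P μ κ) {k : ℕ}
    (hk : Fintype.card ι ≤ k) : ∀ᵐ x, r x ≤ κ k := by
  rcases isEmpty_or_nonempty ι with hι | hι
  · filter_upwards [h.ae_eq_one] with x hx
    exact hx.trans_le (hκ.one_le k)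
  · have h1 := hκ.bound (Fintype.card ι) Fintype.card_pos _
      (isCorrelationFunction_iff_isTupleDensity.2 (h.reindex (Fintype.equivFin ι)))
    have h2 := (measurePreserving_comp_equiv (d := d)
      (Fintype.equivFin ι).symm).quasiMeasurePreserving.ae h1
    filter_upwards [h2] with x hx
    rw [Function.comp_assoc, Equiv.symm_comp_self, Function.comp_id] at hx
    exact hx.trans (hκ.monotone hk)

end TupleDensity

/-! ### Tonelli for products over the fibres of a map -/

section Fubini

theorem lintegral_fin_prod_eq_prod {n : ℕ} {E : Fin n → Type*} {mE : ∀ i, MeasurableSpace (E i)}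
    {μ : (i : Fin n) → Measure (E i)} [∀ i, SigmaFinite (μ i)]
    (f : (i : Fin n) → E i → ℝ≥0∞) (hf : ∀ i, Measurable (f i)) :
    ∫⁻ x : (i : Fin n) → E i, ∏ i, f i (x i) ∂(Measure.pi μ) = ∏ i, ∫⁻ x, f i x ∂(μ i) := by
  induction n with
  | zero => simp [lintegral_const]
  | succ n ih =>
    have hrest : Measurable fun y : (i : Fin n) → E i.succ => ∏ i : Fin n, f i.succ (y i) :=
      Finset.measurable_prod _ fun i _ => (hf i.succ).comp (measurable_pi_apply i)
    calc
      _ = ∫⁻ x : E 0 × ((i : Fin n) → E (Fin.succ i)),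
            f 0 x.1 * ∏ i : Fin n, f (Fin.succ i) (x.2 i)
            ∂((μ 0).prod (Measure.pi fun i => μ i.succ)) := by
        refine (((measurePreserving_piFinSuccAbove μ 0).symm).lintegral_comp_emb
          (MeasurableEquiv.measurableEmbedding _) _).symm.trans (lintegral_congr fun x => ?_)
        rw [Fin.prod_univ_succ]
        rfl
      _ = (∫⁻ x, f 0 x ∂(μ 0)) * ∏ i : Fin n, ∫⁻ x, f (Fin.succ i) x ∂(μ i.succ) := by
        rw [← ih _ fun i => hf i.succ]
        exact lintegral_prod_mul (hf 0).aemeasurable hrest.aemeasurable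
      _ = ∏ i, ∫⁻ x, f i x ∂(μ i) := by rw [Fin.prod_univ_succ]

theorem lintegral_fintype_prod_eq_prod {J : Type*} [Fintype J] {E : J → Type*}
    [∀ i, MeasureSpace (E i)] [∀ i, SigmaFinite (volume : Measure (E i))]
    (f : (i : J) → E i → ℝ≥0∞) (hf : ∀ i, Measurable (f i)) :
    ∫⁻ x : (i : J) → E i, ∏ i, f i (x i) = ∏ i, ∫⁻ x, f i x := by
  let e := (Fintype.equivFin J).symm
  rw [← (volume_measurePreserving_piCongrLeft E e).lintegral_comp_emb
    (MeasurableEquiv.measurableEmbedding _)]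
  simp_rw [← e.prod_comp, MeasurableEquiv.coe_piCongrLeft, Equiv.piCongrLeft_apply_apply]
  exact lintegral_fin_prod_eq_prod (fun i => f (e i)) fun i => hf (e i)

variable {ι J : Type*} (f : ι → J) (X : Type*)

/-- Glue families indexed by the fibres of `f`. -/
@[simps]
def piFibers : ((i : J) → {j // f j = i} → X) ≃ (ι → X) where
  toFun y j := y (f j) ⟨j, rfl⟩
  invFun x _ j := x j.1
  left_inv y := by
    ext i ⟨j, rfl⟩
    rfl
  right_inv x := rfl

theorem piFibers_preimage_pi (B : ι → Set X) :
    piFibers f X ⁻¹' Set.univ.pi B =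
      Set.univ.pi fun i => Set.univ.pi fun j : {j // f j = i} => B j.1 := by
  ext y
  simp only [Set.mem_preimage, Set.mem_univ_pi, piFibers_apply]
  constructor
  · rintro h i ⟨j, rfl⟩
    exact h j
  · intro h j
    exact h (f j) ⟨j, rfl⟩

/-- The preimage of a box is a box of boxes, so both volumes are the same product of side volumes,
grouped by fibre. -/
theorem volume_preserving_piFibers [Fintype ι] [Fintype J] [DecidableEq J] [MeasureSpace X]
    [SigmaFinite (volume : Measure X)] : MeasurePreserving (piFibers f X) := by
  have hm : Measurable (piFibers f X) := measurable_pi_lambda _ fun j =>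
    (measurable_pi_apply (⟨j, rfl⟩ : {j' // f j' = f j})).comp (measurable_pi_apply (f j))
  refine ⟨hm, (Measure.pi_eq fun B hB => ?_).symm⟩
  rw [Measure.map_apply hm (MeasurableSet.univ_pi hB), piFibers_preimage_pi, volume_pi_pi]
  simp_rw [volume_pi_pi]
  exact Fintype.prod_fiberwise f fun j => volume (B j)

end Fubini

/-! ### Tuples with a prescribed colouring -/

section Superposition

open Configuration

variable {Ω : Type*} [MeasurableSpace Ω] {d : ℕ}

/-- Tuples that are injective on each fibre of `f`. -/
def fiberInjective (d : ℕ) {ι J : Type*} (f : ι → J) : Set (ι → EuclideanSpace ℝ (Fin d)) :=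
  {x | ∀ i, Function.Injective fun j : {j // f j = i} => x j}

theorem measurableSet_fiberInjective {ι J : Type*} [Finite ι] [Countable J] (f : ι → J) :
    MeasurableSet (fiberInjective d f) := by
  have : fiberInjective d f = ⋂ i, (fun (x : ι → EuclideanSpace ℝ (Fin d))
      (j : {j // f j = i}) => x j) ⁻¹' {y | Function.Injective y} := by
    ext x
    simp [fiberInjective]
  rw [this]
  exact MeasurableSet.iInter fun i =>
    (measurable_pi_lambda _ fun j => measurable_pi_apply j.1) measurableSet_injective

/-- Distinctness is only required within a fibre, so the choices for different colours do not
interact. Injectivity of the whole tuple would couple the fibres and destroy this factorization. -/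
theorem encard_fiberInjective_inter_pi {ι J : Type*} [Fintype J] (f : ι → J) (S : J → Configuration d)
    (B : ι → Set (EuclideanSpace ℝ (Fin d))) :
    (tuples (fun j => S (f j)) ∩ (fiberInjective d f ∩ Set.univ.pi B)).encard =
      ∏ i, (distinctTuples {j // f j = i} (S i) ∩
        Set.univ.pi fun j : {j // f j = i} => B j.1).encard := by
  rw [← Set.encard_univ_pi, ← (piFibers f _).injective.encard_image]
  congr 1
  rw [Equiv.image_eq_preimage_symm]
  ext x
  simp only [tuples, fiberInjective, distinctTuples, Set.mem_inter_iff, Set.mem_univ_pi,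
    Set.mem_ofPred_eq, Set.mem_preimage, piFibers_symm_apply]
  constructor
  · rintro ⟨h1, h2, h3⟩ i
    refine ⟨⟨h2 i, ?_⟩, fun j => h3 j.1⟩
    rintro ⟨j, rfl⟩
    exact h1 j
  · intro h
    exact ⟨fun j => (h (f j)).1.2 ⟨j, rfl⟩, fun i => (h i).1.1, fun j => (h (f j)).2 ⟨j, rfl⟩⟩

variable {ι J : Type*} [Fintype ι] [Fintype J] [DecidableEq J]

/-- Both sides are measures in `A`. On boxes the count is a product over colours, whose expectation
factorizes by independence, and Tonelli over the fibres does the same to the right side. Boxes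
determine the measure once it is finite on an exhausting sequence. -/
theorem lintegral_encard_fiberInjective {μ : Measure Ω} {X : J → Ω → Configuration d}
    (hX : ∀ i, Measurable (X i)) (hind : iIndepFun X μ) (f : ι → J)
    {r : (i : J) → ({j // f j = i} → EuclideanSpace ℝ (Fin d)) → ℝ}
    (hr : ∀ i, IsTupleDensity (X i) μ {j // f j = i} (r i)) {K : ℝ}
    (hK : ∀ i, ∀ᵐ x, r i x ≤ K) {A : Set (ι → EuclideanSpace ℝ (Fin d))} (hA : MeasurableSet A) :
    ∫⁻ ω, ((tuples (fun j => X (f j) ω) ∩ (fiberInjective d f ∩ A)).encard : ℝ≥0∞) ∂μ =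
      ∫⁻ x in A, ∏ i, ENNReal.ofReal (r i fun j => x j) := by
  have hT : Measurable fun ω => tupleMeasure fun j => X (f j) ω :=
    measurable_tupleMeasure.comp (measurable_pi_lambda _ fun j => hX (f j))
  have hF := measurableSet_fiberInjective (d := d) f
  let ν : Measure (ι → EuclideanSpace ℝ (Fin d)) :=
    (μ.bind fun ω => tupleMeasure fun j => X (f j) ω).restrict (fiberInjective d f)
  have hν : ∀ A, MeasurableSet A → ν A =
      ∫⁻ ω, ((tuples (fun j => X (f j) ω) ∩ (fiberInjective d f ∩ A)).encard : ℝ≥0∞) ∂μ := by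
    intro A hA
    rw [Measure.restrict_apply hA, Measure.bind_apply (hA.inter hF) hT.aemeasurable]
    refine lintegral_congr fun ω => ?_
    rw [tupleMeasure_apply _ (hA.inter hF), Set.inter_comm A]
  have hrect : ∀ B : ι → Set (EuclideanSpace ℝ (Fin d)), (∀ j, MeasurableSet (B j)) →
      ν (Set.univ.pi B) =
        ∏ i, ∫⁻ y in Set.univ.pi fun j : {j // f j = i} => B j.1, ENNReal.ofReal (r i y) := by
    intro B hB
    have hB' : ∀ i, MeasurableSet (Set.univ.pi fun j : {j // f j = i} => B j.1) := fun i =>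
      MeasurableSet.univ_pi fun j => hB j.1
    rw [hν _ (MeasurableSet.univ_pi hB)]
    have hfac : ∀ ω, ((tuples (fun j => X (f j) ω) ∩
        (fiberInjective d f ∩ Set.univ.pi B)).encard : ℝ≥0∞) =
          ∏ i, ((distinctTuples {j // f j = i} (X i ω) ∩
            Set.univ.pi fun j : {j // f j = i} => B j.1).encard : ℝ≥0∞) := fun ω => by
      rw [← ENat.toENNReal_prod, ← encard_fiberInjective_inter_pi f (fun i => X i ω) B]
    simp_rw [hfac]
    rw [lintegral_prod_eq_prod_lintegral_of_indepFun Finset.univ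
      (fun i ω => ((distinctTuples {j // f j = i} (X i ω) ∩
        Set.univ.pi fun j : {j // f j = i} => B j.1).encard : ℝ≥0∞))
      (hind.comp _ fun i => measurable_encard_distinctTuples (hB' i))
      (fun i => (measurable_encard_distinctTuples (hB' i)).comp (hX i))]
    exact Finset.prod_congr rfl fun i _ => (hr i).density _ (hB' i)
  have hrm : ∀ i, Measurable fun y => ENNReal.ofReal (r i y) := fun i =>
    (hr i).measurable.ennreal_ofReal
  have hG : Measurable fun x : ι → EuclideanSpace ℝ (Fin d) =>
      ∏ i, ENNReal.ofReal (r i fun j => x j) :=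
    Finset.measurable_prod _ fun i _ =>
      (hrm i).comp (measurable_pi_lambda _ fun j => measurable_pi_apply j.1)
  have hrect' : ∀ B : ι → Set (EuclideanSpace ℝ (Fin d)), (∀ j, MeasurableSet (B j)) →
      ∫⁻ x in Set.univ.pi B, ∏ i, ENNReal.ofReal (r i fun j => x j) =
        ∏ i, ∫⁻ y in Set.univ.pi fun j : {j // f j = i} => B j.1, ENNReal.ofReal (r i y) := by
    intro B hB
    have hB' : ∀ i, MeasurableSet (Set.univ.pi fun j : {j // f j = i} => B j.1) := fun i =>
      MeasurableSet.univ_pi fun j => hB j.1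
    rw [← (volume_preserving_piFibers f _).setLIntegral_comp_preimage (MeasurableSet.univ_pi hB) hG,
      piFibers_preimage_pi]
    have hsymm : ∀ (y : (i : J) → {j // f j = i} → EuclideanSpace ℝ (Fin d)) (i : J),
        (fun j : {j // f j = i} => piFibers f _ y j.1) = y i := fun y i =>
      congrFun ((piFibers f _).symm_apply_apply y) i
    simp_rw [hsymm]
    rw [← lintegral_indicator (MeasurableSet.univ_pi hB')]
    simp_rw [← lintegral_indicator (hB' _)]
    rw [← lintegral_fintype_prod_eq_prod _ fun i => (hrm i).indicator (hB' i)]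
    refine lintegral_congr fun y => ?_
    by_cases hy : y ∈ Set.univ.pi fun i => Set.univ.pi fun j : {j // f j = i} => B j.1
    · rw [Set.indicator_of_mem hy]
      exact Finset.prod_congr rfl fun i _ => (Set.indicator_of_mem (hy i (Set.mem_univ i))
        fun y => ENNReal.ofReal (r i y)).symm
    · rw [Set.indicator_of_notMem hy]
      obtain ⟨i, hi⟩ := not_forall.1 fun h => hy (Set.mem_univ_pi.2 h)
      exact (Finset.prod_eq_zero (Finset.mem_univ i) (Set.indicator_of_notMem hi _)).symm
  rw [← hν A hA, ← withDensity_apply _ hA]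
  congr 1
  refine Measure.ext_of_generateFrom_of_iUnion _ (tupleBall ι d) generateFrom_pi.symm
    isPiSystem_pi iUnion_tupleBall ?_ ?_ ?_
  · exact fun n => ⟨fun _ => Metric.ball 0 (n : ℝ),
      fun _ _ => measurableSet_ball (x := (0 : EuclideanSpace ℝ (Fin d))) (ε := n), rfl⟩
  · intro n
    -- The bound `K` enters only here: bounded densities have finite integrals over bounded boxes.
    rw [tupleBall, hrect _ fun _ => measurableSet_ball]
    refine (ENNReal.prod_lt_top fun i _ => ?_).ne
    refine (lintegral_mono_ae (g := fun _ => ENNReal.ofReal K)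
      (ae_restrict_of_ae ((hK i).mono fun x hx => ENNReal.ofReal_le_ofReal hx))).trans_lt ?_
    rw [lintegral_const, Measure.restrict_apply_univ, volume_pi_pi]
    exact ENNReal.mul_lt_top ENNReal.ofReal_lt_top
      (ENNReal.prod_lt_top fun _ _ => measure_ball_lt_top)
  · rintro _ ⟨B, hB, rfl⟩
    have hB' : ∀ j, MeasurableSet (B j) := fun j => hB j (Set.mem_univ j)
    rw [hrect B hB', withDensity_apply _ (MeasurableSet.univ_pi hB'), hrect' B hB']

end Superposition

/-! ### Disjointness of the copies, and law and densities of the union -/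

section Superposition

open Configuration

variable {Ω Ω' : Type*} [MeasurableSpace Ω] [MeasurableSpace Ω'] {d : ℕ}

theorem volume_eq_coord (hd : 1 ≤ d) {ι : Type*} [Fintype ι] {i j : ι} (hij : i ≠ j) :
    volume {x : ι → EuclideanSpace ℝ (Fin d) | x i = x j} = 0 := by
  classical
  let L : (ι → EuclideanSpace ℝ (Fin d)) →ₗ[ℝ] EuclideanSpace ℝ (Fin d) :=
    LinearMap.proj (R := ℝ) (φ := fun _ : ι => EuclideanSpace ℝ (Fin d)) i - LinearMap.proj j
  have hL : {x : ι → EuclideanSpace ℝ (Fin d) | x i = x j} = (LinearMap.ker L : Set _) := by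
    ext x
    simp [L, sub_eq_zero]
  rw [hL]
  refine Measure.addHaar_submodule volume _ fun htop => ?_
  let u : EuclideanSpace ℝ (Fin d) := EuclideanSpace.single ⟨0, hd⟩ 1
  have h : Pi.single i u ∈ LinearMap.ker L := htop ▸ Submodule.mem_top
  have h0 : u = 0 := by simpa [L, Pi.single_eq_of_ne' hij, sub_eq_zero] using h
  simp [u] at h0

theorem ae_injective (hd : 1 ≤ d) {ι : Type*} [Fintype ι] :
    ∀ᵐ x : ι → EuclideanSpace ℝ (Fin d), Function.Injective x := by
  have h : ∀ᵐ x : ι → EuclideanSpace ℝ (Fin d), ∀ i j, i ≠ j → x i ≠ x j :=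
    ae_all_iff.2 fun i => ae_all_iff.2 fun j => by
      by_cases hij : i = j
      · simp [hij]
      · have := volume_eq_coord hd hij
        filter_upwards [measure_eq_zero_iff_ae_notMem.1 this] with x hx _
        exact hx
  filter_upwards [h] with x hx i j hij
  exact not_imp_not.1 (hx i j) hij

variable {μ : Measure Ω}

/-- Apply the coloured counting formula to one point from each of the two copies, with `A` the
diagonal: the right side is an integral over a null set. -/
theorem ae_disjoint_points (hd : 1 ≤ d) {J : Type*} [Fintype J] {X : J → Ω → Configuration d}
    (hX : ∀ i, Measurable (X i)) (hind : iIndepFun X μ) {K : ℝ}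
    (hr : ∀ (ι : Type) [Fintype ι] (i : J), Fintype.card ι ≤ 2 →
      ∃ r, IsTupleDensity (X i) μ ι r ∧ ∀ᵐ x, r x ≤ K) {i i' : J} (hii : i ≠ i') :
    ∀ᵐ ω ∂μ, Disjoint (X i ω).points (X i' ω).points := by
  classical
  let f : Fin 2 → J := ![i, i']
  have hf : Function.Injective f := by
    intro a b hab
    fin_cases a <;> fin_cases b <;> simp_all [f, eq_comm]
  have hr' : ∀ l : J, ∃ r, IsTupleDensity (X l) μ {j // f j = l} r ∧ ∀ᵐ x, r x ≤ K := fun l =>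
    hr _ l ((Fintype.card_subtype_le _).trans (Fintype.card_fin 2).le)
  choose r hr1 hr2 using hr'
  let A : Set (Fin 2 → EuclideanSpace ℝ (Fin d)) := {x | x 0 = x 1}
  have hA : MeasurableSet A := measurableSet_eq_coord 0 1
  have h := lintegral_encard_fiberInjective hX hind f hr1 hr2 hA
  rw [Measure.restrict_eq_zero.2 (volume_eq_coord hd (by decide)), lintegral_zero_measure,
    lintegral_eq_zero_iff] at h
  · filter_upwards [h] with ω hω
    rw [Pi.zero_apply, ENat.toENNReal_eq_zero, Set.encard_eq_zero] at hω
    refine Set.disjoint_left.2 fun y hy hy' => ?_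
    refine Set.notMem_empty (![y, y] : Fin 2 → EuclideanSpace ℝ (Fin d)) (hω ▸ ⟨?_, ?_, rfl⟩)
    · refine Set.mem_univ_pi.2 (Fin.forall_fin_two.2 ⟨hy, hy'⟩)
    -- The pair `![y, y]` is not injective but still counts: `f` is injective, so each fibre has at
    -- most one element.
    · rintro l ⟨a, ha⟩ ⟨b, hb⟩ -
      exact Subtype.ext (hf (ha.trans hb.symm))
  · exact (measurable_encard_tuples ((measurableSet_fiberInjective f).inter hA)).comp
      (measurable_pi_lambda _ fun j => hX (f j))

/-- Disjointness makes the colouring of a tuple unique, so the sets for different `f` partition the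
tuples of the union. -/
theorem encard_distinctTuples_iUnion {ι : Type*} [Fintype ι] [DecidableEq ι] {m : ℕ}
    {S : Fin m → Configuration d}
    (hS : ∀ i j, i ≠ j → Disjoint (S i).points (S j).points)
    (A : Set (ι → EuclideanSpace ℝ (Fin d))) :
    ((distinctTuples ι (iUnion S) ∩ A).encard : ℝ≥0∞) =
      ∑ f : ι → Fin m,
        ((tuples (fun j => S (f j)) ∩ ({x | Function.Injective x} ∩ A)).encard : ℝ≥0∞) := by
  have hU : distinctTuples ι (iUnion S) ∩ A =
      ⋃ f : ι → Fin m, tuples (fun j => S (f j)) ∩ ({x | Function.Injective x} ∩ A) := by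
    ext x
    simp only [distinctTuples, iUnion, tuples, Set.mem_inter_iff, Set.mem_ofPred_eq,
      Set.mem_iUnion, Set.mem_univ_pi]
    constructor
    · rintro ⟨⟨h1, h2⟩, h3⟩
      choose f hf using h2
      exact ⟨f, hf, h1, h3⟩
    · rintro ⟨f, hf, h1, h3⟩
      exact ⟨⟨h1, fun j => ⟨f j, hf j⟩⟩, h3⟩
  have hm : ∀ f : ι → Fin m,
      MeasurableSet (tuples (fun j => S (f j)) ∩ ({x | Function.Injective x} ∩ A)) := fun f =>
    ((countable_tuples _).mono Set.inter_subset_left).measurableSet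
  have hd : Pairwise (Function.onFun Disjoint fun f : ι → Fin m =>
      tuples (fun j => S (f j)) ∩ ({x | Function.Injective x} ∩ A)) := by
    intro f g hfg
    refine Set.disjoint_left.2 fun x hx hx' => hfg (funext fun j => ?_)
    by_contra hj
    exact Set.disjoint_left.1 (hS _ _ hj) (hx.1 j (Set.mem_univ j)) (hx'.1 j (Set.mem_univ j))
  rw [hU, ← Measure.count_apply (MeasurableSet.iUnion hm),
    measure_iUnion hd hm, tsum_fintype]
  exact Finset.sum_congr rfl fun f _ => Measure.count_apply (hm f)

theorem isTupleDensity_superposition (hd : 1 ≤ d) {m : ℕ} {X : Fin m → Ω → Configuration d}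
    (hX : ∀ i, Measurable (X i)) (hind : iIndepFun X μ)
    (hdisj : ∀ i j, i ≠ j → ∀ᵐ ω ∂μ, Disjoint (X i ω).points (X j ω).points)
    {ι : Type*} [Fintype ι] [DecidableEq ι]
    {r : (f : ι → Fin m) → (i : Fin m) → ({j // f j = i} → EuclideanSpace ℝ (Fin d)) → ℝ}
    (hr : ∀ f i, IsTupleDensity (X i) μ {j // f j = i} (r f i)) {K : ℝ}
    (hK : ∀ f i, ∀ᵐ x, r f i x ≤ K) :
    IsTupleDensity (superposition X) μ ι
      fun x => ∑ f : ι → Fin m, ∏ i, r f i fun j => x j where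
  measurable := Finset.measurable_sum _ fun f _ => Finset.measurable_prod _ fun i _ =>
    (hr f i).measurable.comp (measurable_pi_lambda _ fun j => measurable_pi_apply j.1)
  nonneg x := Finset.sum_nonneg fun f _ => Finset.prod_nonneg fun i _ => (hr f i).nonneg _
  density A hA := by
    have hI := measurableSet_injective (d := d) (ι := ι)
    have h1 : ∀ᵐ ω ∂μ, ((distinctTuples ι (superposition X ω) ∩ A).encard : ℝ≥0∞) =
        ∑ f : ι → Fin m,
          ((tuples (fun j => X (f j) ω) ∩ ({x | Function.Injective x} ∩ A)).encard : ℝ≥0∞) := by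
      have : ∀ᵐ ω ∂μ, ∀ i j, i ≠ j → Disjoint (X i ω).points (X j ω).points :=
        ae_all_iff.2 fun i => ae_all_iff.2 fun j => by
          by_cases hij : i = j
          · simp [hij]
          · filter_upwards [hdisj i j hij] with ω hω _ using hω
      filter_upwards [this] with ω hω
      exact encard_distinctTuples_iUnion hω A
    have h2 : ∀ f : ι → Fin m,
        ∫⁻ ω, ((tuples (fun j => X (f j) ω) ∩
          ({x | Function.Injective x} ∩ A)).encard : ℝ≥0∞) ∂μ =
            ∫⁻ x in A, ENNReal.ofReal (∏ i, r f i fun j => x j) := by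
      intro f
      -- Injective tuples are injective on fibres, so the coloured formula applies on this smaller
      -- set; the set removed from `A` is Lebesgue-null.
      have hsub : {x : ι → EuclideanSpace ℝ (Fin d) | Function.Injective x} ∩ A =
          fiberInjective d f ∩ ({x | Function.Injective x} ∩ A) :=
        (Set.inter_eq_right.2 fun x hx i => hx.1.comp Subtype.val_injective).symm
      rw [hsub, lintegral_encard_fiberInjective hX hind f (hr f) (hK f) (hI.inter hA)]
      have hae : ({x : ι → EuclideanSpace ℝ (Fin d) | Function.Injective x} ∩ A : Set _)
          =ᵐ[volume] A := by
        filter_upwards [ae_injective hd (ι := ι)] with x hx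
        exact propext (and_iff_right hx)
      rw [setLIntegral_congr hae]
      refine lintegral_congr fun x => ?_
      rw [ENNReal.ofReal_prod_of_nonneg fun i _ => (hr f i).nonneg _]
    rw [lintegral_congr_ae h1, lintegral_finsetSum]
    · simp_rw [h2]
      rw [← lintegral_finsetSum]
      · refine lintegral_congr fun x => ?_
        rw [ENNReal.ofReal_sum_of_nonneg fun f _ =>
          Finset.prod_nonneg fun i _ => (hr f i).nonneg _]
      · exact fun f _ => (Finset.measurable_prod _ fun i _ =>
          (hr f i).measurable.comp
            (measurable_pi_lambda _ fun j => measurable_pi_apply j.1)).ennreal_ofReal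
    · exact fun f _ => (measurable_encard_tuples (hI.inter hA)).comp
        (measurable_pi_lambda _ fun j => hX (f j))

theorem measurable_superposition {m : ℕ} {X : Fin m → Ω → Configuration d}
    (hX : ∀ i, Measurable (X i)) : Measurable (superposition X) :=
  measurable_iUnion.comp (measurable_pi_lambda _ hX)

theorem intensity_superposition_pos {m : ℕ} {X : Fin m → Ω → Configuration d} {i : Fin m}
    (h : 0 < intensity (X i) μ) : 0 < intensity (superposition X) μ :=
  h.trans_le <| lintegral_mono fun _ => ENat.toENNReal_le.2 <| Set.encard_le_encard <|
    Set.inter_subset_inter_left _ (Set.subset_iUnion (fun i => (X i _).points) i)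

theorem measurable_encard_points {A : Set (EuclideanSpace ℝ (Fin d))}
    (hA : MeasurableSet A) (hA' : Bornology.IsBounded A) :
    Measurable fun S : Configuration d => ((S.points ∩ A).encard : ℝ≥0∞) := by
  simp_rw [fun S : Configuration d => S.encard_points_inter hA']
  exact (measurable_from_top (f := fun k : ℕ => (k : ℝ≥0∞))).comp (measurable_count hA hA')

theorem measurableSet_unitCube :
    MeasurableSet {x : EuclideanSpace ℝ (Fin d) | ∀ i, |x i| ≤ 1 / 2} := by
  have : {x : EuclideanSpace ℝ (Fin d) | ∀ i, |x i| ≤ 1 / 2} = ⋂ i, {x | |x i| ≤ 1 / 2} := by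
    ext; simp
  rw [this]
  exact MeasurableSet.iInter fun i => measurableSet_le (by fun_prop) measurable_const

theorem isBounded_unitCube :
    Bornology.IsBounded {x : EuclideanSpace ℝ (Fin d) | ∀ i, |x i| ≤ 1 / 2} := by
  refine (Metric.isBounded_closedBall (x := 0) (r := √(∑ _i : Fin d, 1))).subset fun x hx => ?_
  rw [mem_closedBall_zero_iff, EuclideanSpace.norm_eq]
  refine Real.sqrt_le_sqrt (Finset.sum_le_sum fun i _ => ?_)
  have : ‖x i‖ ≤ 1 / 2 := hx i
  nlinarith [norm_nonneg (x i)]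

theorem intensity_superposition_lt_top {m : ℕ} {X : Fin m → Ω → Configuration d}
    (hX : ∀ i, Measurable (X i)) (h : ∀ i, intensity (X i) μ < ∞) :
    intensity (superposition X) μ < ∞ := by
  have hle : intensity (superposition X) μ ≤ ∑ i, intensity (X i) μ := by
    simp only [intensity]
    have hm : ∀ i, Measurable fun ω =>
        (((X i ω).points ∩ {x | ∀ i, |x i| ≤ 1 / 2}).encard : ℝ≥0∞) := fun i =>
      (measurable_encard_points measurableSet_unitCube isBounded_unitCube).comp (hX i)
    rw [← lintegral_finsetSum _ fun i _ => hm i]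
    refine lintegral_mono fun ω => ?_
    have hc : ∀ S : Configuration d, MeasurableSet (S.points ∩ {x | ∀ i, |x i| ≤ 1 / 2}) :=
      fun S => (S.countable_points.mono Set.inter_subset_left).measurableSet
    simp_rw [← Measure.count_apply (hc _)]
    change Measure.count ((⋃ i, (X i ω).points) ∩ _) ≤ _
    rw [Set.iUnion_inter]
    exact measure_iUnion_fintype_le _ _
  exact hle.trans_lt (ENNReal.sum_lt_top.2 fun i _ => h i)

/-- By independence the joint law is the product of the marginals, so the marginals determine the
law of the union. Applied to translated copies, this gives stationarity. -/
theorem identDistrib_superposition {m : ℕ} {X : Fin m → Ω → Configuration d}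
    {Y : Fin m → Ω' → Configuration d} {μ' : Measure Ω'}
    (hX : iIndepFun X μ) (hY : iIndepFun Y μ') (h : ∀ i, IdentDistrib (X i) (Y i) μ μ') :
    IdentDistrib (superposition X) (superposition Y) μ μ' := by
  have : IsProbabilityMeasure μ := hX.isProbabilityMeasure
  have : IsProbabilityMeasure μ' := hY.isProbabilityMeasure
  have h' : IdentDistrib (fun ω i => X i ω) (fun ω i => Y i ω) μ μ' := by
    refine ⟨aemeasurable_pi_lambda _ fun i => (h i).aemeasurable_fst,
      aemeasurable_pi_lambda _ fun i => (h i).aemeasurable_snd, ?_⟩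
    rw [(iIndepFun_iff_map_fun_eq_pi_map fun i => (h i).aemeasurable_fst).1 hX,
      (iIndepFun_iff_map_fun_eq_pi_map fun i => (h i).aemeasurable_snd).1 hY]
    simp_rw [(h _).map_eq]
  exact h'.comp measurable_iUnion

theorem translate_superposition {Θ : Type*} {m : ℕ} (X : Fin m → Θ → Configuration d)
    (v : EuclideanSpace ℝ (Fin d)) :
    (fun ω => (superposition X ω).translate v) = superposition fun i ω => (X i ω).translate v := by
  ext ω x
  simp [superposition, iUnion, Configuration.translate, Set.image_iUnion]

end Superposition

/-! ### Telescoping estimate for products -/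

theorem Finset.abs_prod_sub_prod_le {J : Type*} (s : Finset J) {f g : J → ℝ} {K δ : ℝ}
    (hf0 : ∀ i ∈ s, 0 ≤ f i) (hfK : ∀ i ∈ s, f i ≤ K) (hg0 : ∀ i ∈ s, 0 ≤ g i)
    (hgK : ∀ i ∈ s, g i ≤ K) (h : ∀ i ∈ s, |f i - g i| ≤ δ) (hK : 0 ≤ K) :
    |∏ i ∈ s, f i - ∏ i ∈ s, g i| ≤ s.card * K ^ (s.card - 1) * δ := by
  classical
  induction s using Finset.induction_on with
  | empty => simp
  | insert a s ha ih =>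
    simp only [Finset.forall_mem_insert] at hf0 hfK hg0 hgK h
    rw [Finset.prod_insert ha, Finset.prod_insert ha, Finset.card_insert_of_notMem ha]
    have ih' := ih hf0.2 hfK.2 hg0.2 hgK.2 h.2
    have hp : ∏ i ∈ s, f i ≤ K ^ s.card := 
      (Finset.prod_le_prod hf0.2 hfK.2).trans_eq (Finset.prod_const K)
    have hp0 : 0 ≤ ∏ i ∈ s, f i := Finset.prod_nonneg hf0.2
    have hδ : 0 ≤ δ := (abs_nonneg _).trans h.1
    have hsplit : f a * ∏ i ∈ s, f i - g a * ∏ i ∈ s, g i =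
        (f a - g a) * ∏ i ∈ s, f i + g a * (∏ i ∈ s, f i - ∏ i ∈ s, g i) := by ring
    have h1 : |(f a - g a) * ∏ i ∈ s, f i| ≤ δ * K ^ s.card := by
      rw [abs_mul, abs_of_nonneg hp0]
      exact mul_le_mul h.1 hp hp0 hδ
    have h2 : |g a * (∏ i ∈ s, f i - ∏ i ∈ s, g i)| ≤ s.card * K ^ s.card * δ := by
      rw [abs_mul, abs_of_nonneg hg0.1]
      refine (mul_le_mul hgK.1 ih' (abs_nonneg _) hK).trans ?_
      -- The natural subtraction in the exponent needs the empty case apart; there the prefactor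
      -- `s.card` vanishes.
      rcases Nat.eq_zero_or_pos s.card with h0 | h0
      · simp [h0]
      · obtain ⟨n, hn⟩ := Nat.exists_eq_add_of_le' h0
        rw [hn, Nat.add_sub_cancel, pow_succ]
        exact le_of_eq (by ring)
    rw [hsplit, Nat.add_sub_cancel]
    refine (abs_add_le _ _).trans ((add_le_add h1 h2).trans (le_of_eq ?_))
    push_cast
    ring

/-! ### Mixing and product bounds for the original process -/

section Mixing

open Configuration

variable {Ω : Type*} [MeasurableSpace Ω] {d : ℕ} {P : Ω → Configuration d} {μ : Measure Ω}
  {φ : ℝ → ℝ} {C c : ℕ → ℝ}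
  {α β : Type*} [Fintype α] [Fintype β]
  {s : (α ⊕ β → EuclideanSpace ℝ (Fin d)) → ℝ} {a : (α → EuclideanSpace ℝ (Fin d)) → ℝ}
  {b : (β → EuclideanSpace ℝ (Fin d)) → ℝ}

theorem IsFastDecreasing.tendsto_zero (h : IsFastDecreasing φ) : Tendsto φ atTop (𝓝 0) := by
  have h1 := (h.decay 1 le_rfl).mul tendsto_inv_atTop_zero
  rw [zero_mul] at h1
  refine h1.congr' ?_
  filter_upwards [eventually_gt_atTop 0] with x hx
  field_simp

theorem HasFastDecay.mixing_sum (h : HasFastDecay P μ φ C c) [Nonempty α] [Nonempty β]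
    (hs : IsTupleDensity P μ (α ⊕ β) s) (ha : IsTupleDensity P μ α a)
    (hb : IsTupleDensity P μ β b) :
    ∀ᵐ z, |s z - a (z ∘ Sum.inl) * b (z ∘ Sum.inr)| ≤
      C (Fintype.card α + Fintype.card β) * φ (c (Fintype.card α + Fintype.card β) *
        ⨅ ij : α × β, dist (z (Sum.inl ij.1)) (z (Sum.inr ij.2))) := by
  choose ρ hρ using h.admissible.exists_correlation
  have hρ' := fun k => isCorrelationFunction_iff_isTupleDensity.1 (hρ k)
  let eα := Fintype.equivFin α
  let eβ := Fintype.equivFin β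
  let e : α ⊕ β ≃ Fin (Fintype.card α + Fintype.card β) :=
    (Equiv.sumCongr eα eβ).trans finSumFinEquiv
  have hel : ∀ i, e.symm (Fin.castAdd _ (eα i)) = Sum.inl i := fun i =>
    e.symm_apply_eq.2 rfl
  have her : ∀ i, e.symm (Fin.natAdd _ (eβ i)) = Sum.inr i := fun i =>
    e.symm_apply_eq.2 rfl
  have h1 := h.mixing ρ hρ _ _ (Fintype.card_pos (α := α)) (Fintype.card_pos (α := β))
  have h2 := (hs.reindex e).ae_eq (hρ' _)
  have h3 := (quasiMeasurePreserving_comp_injective (d := d)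
    (Fin.castAdd_injective (Fintype.card α) (Fintype.card β))).ae ((ha.reindex eα).ae_eq (hρ' _))
  have h4 := (quasiMeasurePreserving_comp_injective (d := d)
    (Fin.natAdd_injective (Fintype.card β) (Fintype.card α))).ae ((hb.reindex eβ).ae_eq (hρ' _))
  have hall := (measurePreserving_comp_equiv (d := d) e.symm).quasiMeasurePreserving.ae
    (h1.and (h2.and (h3.and h4)))
  filter_upwards [hall] with z hz
  obtain ⟨hz1, hz2, hz3, hz4⟩ := hz
  have hs' : (z ∘ e.symm) ∘ e = z := by rw [Function.comp_assoc, e.symm_comp_self]; rfl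
  have ha' : ((z ∘ e.symm) ∘ Fin.castAdd _) ∘ eα = z ∘ Sum.inl :=
    funext fun i => congrArg z (hel i)
  have hb' : ((z ∘ e.symm) ∘ Fin.natAdd _) ∘ eβ = z ∘ Sum.inr :=
    funext fun i => congrArg z (her i)
  have hdist : blockDist _ _ (z ∘ e.symm) =
      ⨅ ij : α × β, dist (z (Sum.inl ij.1)) (z (Sum.inr ij.2)) := by
    refine ((Equiv.prodCongr eα eβ).iInf_congr fun ij => ?_).symm
    exact congrArg₂ dist (congrArg z (hel _)) (congrArg z (her _))
  rw [hs'] at hz2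
  rw [ha'] at hz3
  rw [hb'] at hz4
  rw [hdist] at hz1
  rw [hz2, hz3, hz4]
  exact hz1

/-- Shift the second block by `n • u`. By stationarity the product is unchanged, while mixing
compares it with a joint density, which is at most `κ k`, up to an error that vanishes as the blocks
separate. -/
theorem HasFastDecay.ae_mul_le [IsProbabilityMeasure μ] (h : HasFastDecay P μ φ C c) (hd : 1 ≤ d)
    {κ : ℕ → ℝ} (hκ : IsCorrelationBound P μ κ)
    (ha : IsTupleDensity P μ α a) (hb : IsTupleDensity P μ β b) {k : ℕ}
    (hk : Fintype.card α + Fintype.card β ≤ k) :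
    ∀ᵐ z : α ⊕ β → EuclideanSpace ℝ (Fin d), a (z ∘ Sum.inl) * b (z ∘ Sum.inr) ≤ κ k := by
  have hl := quasiMeasurePreserving_comp_injective (d := d) (Sum.inl_injective (α := α) (β := β))
  have hr := quasiMeasurePreserving_comp_injective (d := d) (Sum.inr_injective (α := α) (β := β))
  rcases isEmpty_or_nonempty α with hα | hα
  · filter_upwards [hl.ae ha.ae_eq_one, hr.ae (hb.ae_le hκ (k := k) (by lia))] with z h1 h2
    rwa [h1, one_mul]
  rcases isEmpty_or_nonempty β with hβ | hβ
  · filter_upwards [hl.ae (ha.ae_le hκ (k := k) (by lia)), hr.ae hb.ae_eq_one] with z h1 h2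
    rwa [h2, mul_one]
  obtain ⟨s, hs⟩ := h.admissible.exists_isTupleDensity (α ⊕ β)
  let u : EuclideanSpace ℝ (Fin d) := EuclideanSpace.single ⟨0, hd⟩ 1
  have hu : ‖u‖ = 1 := by simp [u]
  let w : ℕ → α ⊕ β → EuclideanSpace ℝ (Fin d) := fun n => Sum.elim (fun _ => 0) fun _ => n • u
  have hw := fun n => (measurePreserving_add_right volume (w n)).quasiMeasurePreserving
  have h1 := ae_all_iff.2 fun n => (hw n).ae (h.mixing_sum hs ha hb)
  have h2 := ae_all_iff.2 fun n => (hw n).ae (hs.ae_le hκ (k := k) (by simpa using hk))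
  have h3 := hr.ae (ae_all_iff.2 fun n : ℕ =>
    (hb.comp_add (n • u) (h.admissible.stationary (n • u))).ae_eq hb)
  filter_upwards [h1, h2, h3] with z h1 h2 h3
  set D : ℕ → ℝ := fun n =>
    ⨅ ij : α × β, dist ((z + w n) (Sum.inl ij.1)) ((z + w n) (Sum.inr ij.2)) with hD
  have hn : Fintype.card α + Fintype.card β ≥ 1 := by
    have := Fintype.card_pos (α := α)
    lia
  have hDlim : Tendsto D atTop atTop := by
    -- Each distance between the blocks is at least `n` minus the norms of two entries of `z`.
    refine tendsto_atTop_mono (f := fun n : ℕ => (n : ℝ) - 2 * ∑ i, ‖z i‖) (fun n => ?_)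
      (tendsto_atTop_add_const_right _ _ tendsto_natCast_atTop_atTop)
    refine le_ciInf fun ij => ?_
    have hsum : ∀ i, ‖z i‖ ≤ ∑ i, ‖z i‖ := fun i =>
      Finset.single_le_sum (f := fun i => ‖z i‖) (fun i _ => norm_nonneg _) (Finset.mem_univ i)
    have e1 : (z + w n) (Sum.inl ij.1) = z (Sum.inl ij.1) := by simp [w]
    have e2 : (z + w n) (Sum.inr ij.2) = z (Sum.inr ij.2) + n • u := by simp [w]
    have e3 : (n : ℝ) = ‖n • u‖ := by
      rw [← Nat.cast_smul_eq_nsmul ℝ, norm_smul, hu]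
      simp
    rw [e1, e2, dist_eq_norm, e3]
    have e4 : n • u = z (Sum.inl ij.1) - z (Sum.inr ij.2) -
        (z (Sum.inl ij.1) - (z (Sum.inr ij.2) + n • u)) := by abel
    have e5 := norm_sub_le (z (Sum.inl ij.1) - z (Sum.inr ij.2))
      (z (Sum.inl ij.1) - (z (Sum.inr ij.2) + n • u))
    rw [← e4] at e5
    have e6 := norm_sub_le (z (Sum.inl ij.1)) (z (Sum.inr ij.2))
    have e7 := hsum (Sum.inl ij.1)
    have e8 := hsum (Sum.inr ij.2)
    linarith
  have hlim : Tendsto (fun n => κ k + C (Fintype.card α + Fintype.card β) *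
      φ (c (Fintype.card α + Fintype.card β) * D n)) atTop (𝓝 (κ k)) := by
    have := (h.fastDecreasing.tendsto_zero.comp
      (hDlim.const_mul_atTop (h.c_pos _ hn))).const_mul (C (Fintype.card α + Fintype.card β))
    simpa using this.const_add (κ k)
  refine ge_of_tendsto' hlim fun n => ?_
  have e1 : (z + w n) ∘ Sum.inl = z ∘ Sum.inl := by
    ext i : 1
    simp [w]
  have e2 : (z + w n) ∘ Sum.inr = z ∘ Sum.inr + fun _ => n • u := by
    ext i : 1
    simp [w]
  have h1n := h1 n
  rw [e1, e2, h3 n] at h1n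
  have := (abs_le.1 h1n).1
  have h2n := h2 n
  linarith

/-- A colour may receive only some of the `k` points, or none from one block. Monotonicity of `C`,
`c` and `φ` covers the first case; in the second the difference vanishes. A lower bound `t` replaces
the infimum, which has no useful value when a block is empty. -/
theorem HasFastDecay.mixing_of_le [IsProbabilityMeasure μ] (h : HasFastDecay P μ φ C c)
    (hs : IsTupleDensity P μ (α ⊕ β) s) (ha : IsTupleDensity P μ α a)
    (hb : IsTupleDensity P μ β b) {k : ℕ} (hk1 : 1 ≤ k)
    (hk : Fintype.card α + Fintype.card β ≤ k) :
    ∀ᵐ z, ∀ t : ℝ, 0 ≤ t → (∀ i j, t ≤ dist (z (Sum.inl i)) (z (Sum.inr j))) →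
      |s z - a (z ∘ Sum.inl) * b (z ∘ Sum.inr)| ≤ C k * φ (c k * t) := by
  have hl := quasiMeasurePreserving_comp_injective (d := d) (Sum.inl_injective (α := α) (β := β))
  have hr := quasiMeasurePreserving_comp_injective (d := d) (Sum.inr_injective (α := α) (β := β))
  have hpos : ∀ t, 0 ≤ t → 0 ≤ C k * φ (c k * t) := fun t ht =>
    mul_nonneg (zero_le_one.trans (h.one_le_C k hk1))
      (h.fastDecreasing.mem_Icc _ (mul_nonneg (h.c_pos k hk1).le ht)).1
  rcases isEmpty_or_nonempty α with hα | hα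
  · filter_upwards [hl.ae ha.ae_eq_one, hs.ae_eq (hb.reindex (Equiv.emptySum α β).symm)]
      with z h1 h2 t ht _
    have h2' : s z = b (z ∘ Sum.inr) := h2
    rw [h1, h2', one_mul, sub_self, abs_zero]
    exact hpos t ht
  rcases isEmpty_or_nonempty β with hβ | hβ
  · filter_upwards [hr.ae hb.ae_eq_one, hs.ae_eq (ha.reindex (Equiv.sumEmpty α β).symm)]
      with z h1 h2 t ht _
    have h2' : s z = a (z ∘ Sum.inl) := h2
    rw [h1, h2', mul_one, sub_self, abs_zero]
    exact hpos t ht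
  have hn : 1 ≤ Fintype.card α + Fintype.card β := by
    have := Fintype.card_pos (α := α)
    lia
  filter_upwards [h.mixing_sum hs ha hb] with z hz t ht htz
  refine hz.trans ?_
  have hinf := le_ciInf fun ij : α × β => htz ij.1 ij.2
  have hc := h.antitone_c (Set.mem_Ici.2 hn) (Set.mem_Ici.2 hk1) hk
  have hle := mul_le_mul hc hinf ht (h.c_pos _ hn).le
  have h0 := mul_nonneg (h.c_pos k hk1).le ht
  exact mul_le_mul (h.monotone_C (Set.mem_Ici.2 hn) (Set.mem_Ici.2 hk1) hk)
    (h.fastDecreasing.antitone (Set.mem_Ici.2 h0) (Set.mem_Ici.2 (h0.trans hle)) hle)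
    (h.fastDecreasing.mem_Icc _ (h0.trans hle)).1 (zero_le_one.trans (h.one_le_C k hk1))

end Mixing

/-! ### Mixing for the union -/

section SuperpositionMixing

open Configuration

variable {Ω Ω' : Type*} [MeasurableSpace Ω] [MeasurableSpace Ω'] {d m : ℕ}
  {μ : Measure Ω} {μ' : Measure Ω'} {P : Ω' → Configuration d} {X : Fin m → Ω → Configuration d}
  {φ : ℝ → ℝ} {C c κ : ℕ → ℝ}

theorem isTupleDensity_superposition_of_copies [IsProbabilityMeasure μ'] (hd : 1 ≤ d)
    (hX : ∀ i, Measurable (X i)) (hcopy : ∀ i, IdentDistrib (X i) P μ μ') (hind : iIndepFun X μ)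
    (hP : IsAdmissible P μ') (hκ : IsCorrelationBound P μ' κ)
    {ι : Type*} [Fintype ι] [DecidableEq ι]
    {r : (f : ι → Fin m) → (i : Fin m) → ({j // f j = i} → EuclideanSpace ℝ (Fin d)) → ℝ}
    (hr : ∀ f i, IsTupleDensity P μ' {j // f j = i} (r f i)) :
    IsTupleDensity (superposition X) μ ι
      fun x => ∑ f : ι → Fin m, ∏ i, r f i fun j => x j := by
  refine isTupleDensity_superposition hd hX hind (fun i j hij => ?_)
    (fun f i => (hr f i).of_identDistrib (hcopy i))
    (fun f i => (hr f i).ae_le hκ (Fintype.card_subtype_le _))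
  -- Only tuples of at most two points occur in the disjointness argument, so `κ 2` is a common
  -- bound.
  refine ae_disjoint_points hd hX hind (K := κ 2) (fun ι' _ l hl => ?_) hij
  obtain ⟨r', hr'⟩ := hP.exists_isTupleDensity ι'
  exact ⟨r', hr'.of_identDistrib (hcopy l), hr'.ae_le hκ hl⟩

theorem isAdmissible_superposition [IsProbabilityMeasure μ'] (hd : 1 ≤ d) (hm : 1 ≤ m)
    (hX : ∀ i, Measurable (X i)) (hcopy : ∀ i, IdentDistrib (X i) P μ μ') (hind : iIndepFun X μ)
    (hP : IsAdmissible P μ') (hκ : IsCorrelationBound P μ' κ) :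
    IsAdmissible (superposition X) μ := by
  have hint : ∀ i, intensity (X i) μ = intensity P μ' := fun i =>
    ((hcopy i).comp (measurable_encard_points measurableSet_unitCube
      isBounded_unitCube)).lintegral_eq
  refine ⟨measurable_superposition hX, fun v => ?_, ?_, ?_, fun k => ?_⟩
  · rw [translate_superposition]
    refine identDistrib_superposition (hind.comp _ fun _ => measurable_translate v) hind fun i => ?_
    exact ((hcopy i).comp (measurable_translate v)).trans
      ((hP.stationary v).trans (hcopy i).symm)
  · exact intensity_superposition_pos (i := ⟨0, hm⟩) ((hint _).symm ▸ hP.intensity_pos)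
  · exact intensity_superposition_lt_top hX fun i => (hint i).symm ▸ hP.intensity_lt_top
  · choose r hr using fun (f : Fin k → Fin m) (i : Fin m) =>
      hP.exists_isTupleDensity {j // f j = i}
    exact ⟨_, isCorrelationFunction_iff_isTupleDensity.2
      (isTupleDensity_superposition_of_copies hd hX hcopy hind hP hκ hr)⟩

/-- For each colour, mixing compares its points in the two blocks, which are at least as far apart
as the whole blocks. Both factors are at most `κ k`, so telescoping over the `m` colours applies. -/
theorem HasFastDecay.abs_prod_fibers_sub_le [IsProbabilityMeasure μ'] (hd : 1 ≤ d)
    (hP : HasFastDecay P μ' φ C c) (hκ : IsCorrelationBound P μ' κ)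
    {α β : Type*} [Fintype α] [Fintype β] (f : α ⊕ β → Fin m)
    {r : (i : Fin m) → ({j // f j = i} → EuclideanSpace ℝ (Fin d)) → ℝ}
    {a : (i : Fin m) → ({j // f (Sum.inl j) = i} → EuclideanSpace ℝ (Fin d)) → ℝ}
    {b : (i : Fin m) → ({j // f (Sum.inr j) = i} → EuclideanSpace ℝ (Fin d)) → ℝ}
    (hr : ∀ i, IsTupleDensity P μ' {j // f j = i} (r i))
    (ha : ∀ i, IsTupleDensity P μ' {j // f (Sum.inl j) = i} (a i))
    (hb : ∀ i, IsTupleDensity P μ' {j // f (Sum.inr j) = i} (b i))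
    {k : ℕ} (hk1 : 1 ≤ k) (hk : Fintype.card α + Fintype.card β ≤ k) :
    ∀ᵐ z : α ⊕ β → EuclideanSpace ℝ (Fin d), ∀ t : ℝ, 0 ≤ t →
      (∀ i j, t ≤ dist (z (Sum.inl i)) (z (Sum.inr j))) →
      |∏ i, r i (fun j => z j) -
        (∏ i, a i fun j => z (Sum.inl j)) * ∏ i, b i fun j => z (Sum.inr j)| ≤
          m * κ k ^ (m - 1) * (C k * φ (c k * t)) := by
  have hcard : ∀ i, Fintype.card {j // f (Sum.inl j) = i} +
      Fintype.card {j // f (Sum.inr j) = i} ≤ k := fun i =>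
    (add_le_add (Fintype.card_subtype_le _) (Fintype.card_subtype_le _)).trans hk
  have h1 : ∀ i, ∀ᵐ z : α ⊕ β → EuclideanSpace ℝ (Fin d), r i (fun j => z j) ≤ κ k := fun i =>
    (quasiMeasurePreserving_comp_injective (d := d)
      (Subtype.val_injective (p := fun j => f j = i))).ae
      ((hr i).ae_le hκ ((Fintype.card_subtype_le _).trans ((Fintype.card_sum).trans_le hk)))
  have hinj : ∀ i, Function.Injective (Sum.map Subtype.val Subtype.val :
      {j // f (Sum.inl j) = i} ⊕ {j // f (Sum.inr j) = i} → α ⊕ β) := fun i =>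
    Subtype.val_injective.sumMap Subtype.val_injective
  have hq := fun i => quasiMeasurePreserving_comp_injective (d := d) (hinj i)
  have h2 := fun i => (hq i).ae (hP.ae_mul_le hd hκ (ha i) (hb i) (hcard i))
  have h3 := fun i => (hq i).ae (hP.mixing_of_le
    ((hr i).reindex (Equiv.subtypeSum (p := fun j => f j = i))) (ha i) (hb i) hk1 (hcard i))
  filter_upwards [ae_all_iff.2 h1, ae_all_iff.2 h2, ae_all_iff.2 h3] with z h1 h2 h3 t ht htz
  rw [← Finset.prod_mul_distrib]
  have key := Finset.abs_prod_sub_prod_le Finset.univ (K := κ k) (δ := C k * φ (c k * t))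
    (f := fun i => r i fun j => z j)
    (g := fun i => (a i fun j => z (Sum.inl j)) * b i fun j => z (Sum.inr j))
    (fun i _ => (hr i).nonneg _) (fun i _ => h1 i)
    (fun i _ => mul_nonneg ((ha i).nonneg _) ((hb i).nonneg _)) (fun i _ => h2 i)
    (fun i _ => ?_) (zero_le_one.trans (hκ.one_le k))
  · rwa [Finset.card_univ, Fintype.card_fin] at key
  · have e : (z ∘ Sum.map Subtype.val Subtype.val) ∘
        (Equiv.subtypeSum (p := fun j => f j = i)) =
          fun j : {j // f j = i} => z j := by
      ext ⟨j | j, hj⟩ : 1 <;> rfl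
    have := h3 i t ht fun i' j' => htz i'.1 j'.1
    rw [e] at this
    exact this

theorem HasFastDecay.mixing_superposition [IsProbabilityMeasure μ'] (hd : 1 ≤ d)
    (hX : ∀ i, Measurable (X i)) (hcopy : ∀ i, IdentDistrib (X i) P μ μ') (hind : iIndepFun X μ)
    (hP : HasFastDecay P μ' φ C c) (hκ : IsCorrelationBound P μ' κ)
    {α β : Type*} [Fintype α] [Fintype β]
    {r : (α ⊕ β → EuclideanSpace ℝ (Fin d)) → ℝ} {a : (α → EuclideanSpace ℝ (Fin d)) → ℝ}
    {b : (β → EuclideanSpace ℝ (Fin d)) → ℝ}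
    (hr : IsTupleDensity (superposition X) μ (α ⊕ β) r)
    (ha : IsTupleDensity (superposition X) μ α a) (hb : IsTupleDensity (superposition X) μ β b)
    {k : ℕ} (hk1 : 1 ≤ k) (hk : Fintype.card α + Fintype.card β = k) :
    ∀ᵐ z : α ⊕ β → EuclideanSpace ℝ (Fin d), ∀ t : ℝ, 0 ≤ t →
      (∀ i j, t ≤ dist (z (Sum.inl i)) (z (Sum.inr j))) →
      |r z - a (z ∘ Sum.inl) * b (z ∘ Sum.inr)| ≤
        m ^ k * (m * κ k ^ (m - 1) * (C k * φ (c k * t))) := by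
  classical
  have hA := hP.admissible
  choose rs hrs using fun (f : α ⊕ β → Fin m) (i : Fin m) =>
    hA.exists_isTupleDensity {j // f j = i}
  choose ra hra using fun (f : α → Fin m) (i : Fin m) => hA.exists_isTupleDensity {j // f j = i}
  choose rb hrb using fun (f : β → Fin m) (i : Fin m) => hA.exists_isTupleDensity {j // f j = i}
  have h1 := hr.ae_eq (isTupleDensity_superposition_of_copies hd hX hcopy hind hA hκ hrs)
  have h2 := (quasiMeasurePreserving_comp_injective (d := d)
    (Sum.inl_injective (α := α) (β := β))).ae
    (ha.ae_eq (isTupleDensity_superposition_of_copies hd hX hcopy hind hA hκ hra))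
  have h3 := (quasiMeasurePreserving_comp_injective (d := d)
    (Sum.inr_injective (α := α) (β := β))).ae
    (hb.ae_eq (isTupleDensity_superposition_of_copies hd hX hcopy hind hA hκ hrb))
  have h4 := ae_all_iff.2 fun f : α ⊕ β → Fin m => hP.abs_prod_fibers_sub_le hd hκ f (hrs f)
    (hra fun j => f (Sum.inl j)) (hrb fun j => f (Sum.inr j)) hk1 hk.le
  filter_upwards [h1, h2, h3, h4] with z h1 h2 h3 h4 t ht htz
  -- A colouring of `α ⊕ β` is a pair of colourings of `α` and `β`, so both expressions become sums
  -- over the same index set and are compared termwise.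
  rw [h1, h2, h3, Finset.sum_mul_sum, ← Finset.sum_product', Finset.univ_product_univ,
    ← (Equiv.sumArrowEquivProdArrow α β (Fin m)).sum_comp, ← Finset.sum_sub_distrib]
  refine (Finset.abs_sum_le_sum_abs _ _).trans
    ((Finset.sum_le_sum fun f _ => h4 f t ht htz).trans_eq ?_)
  rw [Finset.sum_const, Finset.card_univ, Fintype.card_fun, Fintype.card_sum, Fintype.card_fin, hk,
    nsmul_eq_mul, Nat.cast_pow]

theorem HasFastDecay.superposition [IsProbabilityMeasure μ'] (hd : 1 ≤ d) (hm : 1 ≤ m)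
    (hX : ∀ i, Measurable (X i)) (hcopy : ∀ i, IdentDistrib (X i) P μ μ') (hind : iIndepFun X μ)
    (hP : HasFastDecay P μ' φ C c) (hκ : IsCorrelationBound P μ' κ) :
    HasFastDecay (superposition X) μ φ
      (fun k => (m : ℝ) ^ k * (m.factorial : ℝ) * κ k ^ (m - 1) * C k) c where
  admissible := isAdmissible_superposition hd hm hX hcopy hind hP.admissible hκ
  fastDecreasing := hP.fastDecreasing
  one_le_C k hk := by
    have h1 : (1 : ℝ) ≤ m := by exact_mod_cast hm
    have h2 : (1 : ℝ) ≤ m.factorial := by exact_mod_cast m.factorial_pos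
    exact one_le_mul_of_one_le_of_one_le (one_le_mul_of_one_le_of_one_le
      (one_le_mul_of_one_le_of_one_le (one_le_pow₀ h1) h2) (one_le_pow₀ (hκ.one_le k)))
      (hP.one_le_C k hk)
  monotone_C k hk l hl hkl := by
    have h1 : (1 : ℝ) ≤ m := by exact_mod_cast hm
    have h2 : (0 : ℝ) ≤ κ k := zero_le_one.trans (hκ.one_le k)
    have h3 : (0 : ℝ) ≤ κ l := zero_le_one.trans (hκ.one_le l)
    have h4 : (0 : ℝ) ≤ C k := zero_le_one.trans (hP.one_le_C k hk)
    have h5 := hP.monotone_C hk hl hkl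
    have h6 := hκ.monotone hkl
    dsimp only
    gcongr
  c_pos := hP.c_pos
  antitone_c := hP.antitone_c
  mixing ρ hρ p q hp hq := by
    have hρ' := fun k => isCorrelationFunction_iff_isTupleDensity.1 (hρ k)
    have hpq : 1 ≤ p + q := by lia
    have h := hP.mixing_superposition hd hX hcopy hind hκ
      ((hρ' (p + q)).reindex finSumFinEquiv.symm) (hρ' p) (hρ' q) hpq
      (by rw [Fintype.card_fin, Fintype.card_fin])
    have : Nonempty (Fin p × Fin q) := ⟨⟨0, hp⟩, ⟨0, hq⟩⟩
    filter_upwards [(measurePreserving_comp_equiv (d := d)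
      (finSumFinEquiv (m := p) (n := q))).quasiMeasurePreserving.ae h] with x hx
    have ht : 0 ≤ blockDist p q x := Real.iInf_nonneg fun _ => dist_nonneg
    have hx' := hx (blockDist p q x) ht fun i j =>
      ciInf_le (f := fun ij : Fin p × Fin q =>
        dist (x (Fin.castAdd q ij.1)) (x (Fin.natAdd p ij.2)))
        ⟨0, Set.forall_mem_range.2 fun _ => dist_nonneg⟩ (i, j)
    rw [Function.comp_assoc, Equiv.self_comp_symm] at hx'
    refine le_trans hx' ?_
    -- The estimate yields the factor `m`; the stated constant has the larger `m!`.
    have h1 : (m : ℝ) ≤ m.factorial := by exact_mod_cast m.self_le_factorial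
    have h2 : (0 : ℝ) ≤ κ (p + q) := zero_le_one.trans (hκ.one_le _)
    have h3 : (0 : ℝ) ≤ C (p + q) := zero_le_one.trans (hP.one_le_C _ hpq)
    have h4 : 0 ≤ φ (c (p + q) * blockDist p q x) :=
      (hP.fastDecreasing.mem_Icc _ (mul_nonneg (hP.c_pos _ hpq).le ht)).1
    rw [← mul_assoc, ← mul_assoc, ← mul_assoc]
    gcongr

end SuperpositionMixing

/-! ### Growth of the constants for (A2), and the main theorem -/

/-- The prefactor is at most `m!` times `(m * l ^ (m - 1)) ^ k`, and any fixed base is eventually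
below `k ^ ((1 - a) / 2)`. Adding exponents, `a + (1 - a) / 2 = (a + 1) / 2`. -/
theorem isBigO_rpow_mul_of_geometric {m : ℕ} {κ C : ℕ → ℝ} {l a : ℝ} (hl : 0 < l) (hκ1 : ∀ k, 0 ≤ κ k)
    (hκ : ∀ k : ℕ, 1 ≤ k → κ k ≤ l ^ k) (ha : a < 1)
    (hC : C =O[atTop] fun k : ℕ => (k : ℝ) ^ (a * (k : ℝ))) :
    (fun k : ℕ => (m : ℝ) ^ k * (m.factorial : ℝ) * κ k ^ (m - 1) * C k) =O[atTop]
      fun k : ℕ => (k : ℝ) ^ ((a + 1) / 2 * (k : ℝ)) := by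
  have h1 : (fun k : ℕ => (m : ℝ) ^ k * (m.factorial : ℝ) * κ k ^ (m - 1)) =O[atTop]
      fun k : ℕ => (k : ℝ) ^ ((1 - a) / 2 * (k : ℝ)) := by
    refine IsBigO.of_bound (m.factorial : ℝ) ?_
    have hlim : Tendsto (fun k : ℕ => (k : ℝ) ^ ((1 - a) / 2)) atTop atTop :=
      (tendsto_rpow_atTop (by linarith)).comp tendsto_natCast_atTop_atTop
    filter_upwards [hlim.eventually_ge_atTop (m * l ^ (m - 1)), eventually_ge_atTop 1]
      with k hk hk1
    have hb : κ k ^ (m - 1) ≤ (l ^ k) ^ (m - 1) := pow_le_pow_left₀ (hκ1 k) (hκ k hk1) _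
    rw [Real.norm_of_nonneg (mul_nonneg (by positivity) (pow_nonneg (hκ1 k) _)),
      Real.norm_of_nonneg (by positivity), mul_comm ((m : ℝ) ^ k), mul_assoc]
    refine mul_le_mul_of_nonneg_left ?_ (by positivity)
    calc (m : ℝ) ^ k * κ k ^ (m - 1) ≤ (m : ℝ) ^ k * (l ^ k) ^ (m - 1) := by gcongr
      _ = (m * l ^ (m - 1)) ^ k := by rw [mul_pow, ← pow_mul, ← pow_mul, mul_comm k]
      _ ≤ ((k : ℝ) ^ ((1 - a) / 2)) ^ k := pow_le_pow_left₀ (by positivity) hk k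
      _ = (k : ℝ) ^ ((1 - a) / 2 * k) := (Real.rpow_mul_natCast (by positivity) _ _).symm
  refine (h1.mul hC).congr' EventuallyEq.rfl ?_
  filter_upwards [eventually_gt_atTop 0] with k hk
  rw [← Real.rpow_add (by exact_mod_cast hk)]
  congr 1
  ring

theorem mainTheorem6 {d m : ℕ} (hd : 2 ≤ d) (hm : 1 ≤ m)
    {Ω Ω' : Type*} [MeasurableSpace Ω] [MeasurableSpace Ω']
    (μ : Measure Ω) [IsProbabilityMeasure μ] (μ' : Measure Ω') [IsProbabilityMeasure μ']
    (P : Ω' → Configuration d) (Ps : Fin m → Ω → Configuration d)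
    (hmeas : ∀ i, Measurable (Ps i)) (hcopy : ∀ i, IdentDistrib (Ps i) P μ μ')
    (hindep : iIndepFun Ps μ)
    (φ : ℝ → ℝ) (C c κ : ℕ → ℝ)
    (hP : HasFastDecay P μ' φ C c) (hκ : IsCorrelationBound P μ' κ) :
    HasFastDecay (superposition Ps) μ φ
        (fun k => (m : ℝ) ^ k * (m.factorial : ℝ) * κ k ^ (m - 1) * C k) c ∧
      (IsA2Input P μ' → (∃ l : ℝ, 0 < l ∧ ∀ k : ℕ, 1 ≤ k → κ k ≤ l ^ k) →
        IsA2Input (superposition Ps) μ) := by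
  have hd1 : 1 ≤ d := one_le_two.trans hd
  refine ⟨hP.superposition hd1 hm hmeas hcopy hindep hκ, ?_⟩
  rintro ⟨φ', C', hP', ⟨a, ha0, ha1, hC'⟩, b, hb, hbot, hzero⟩ ⟨l, hl, hκl⟩
  exact ⟨φ', _, hP'.superposition hd1 hm hmeas hcopy hindep hκ,
    ⟨(a + 1) / 2, by linarith, by linarith,
      isBigO_rpow_mul_of_geometric hl (fun k => zero_le_one.trans (hκ.one_le k)) hκl ha1 hC'⟩,
    b, hb, hbot, hzero⟩
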